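/- Let $k,\lambda_1,\beta_1,\lambda_2,\beta_2>0$. Let $N_1,N_2$ be Poisson processes with intensities $\lambda_1,\lambda_2$, let $(U_n)_{n\ge1}$ be i.i.d. exponential with rate $\beta_1$ and $(D_m)_{m\ge1}$ i.i.d. exponential with rate $\beta_2$, let $X_0$ be a real random variable, and suppose that $X_0,N_1,(U_n),N_2,(D_m)$ are mutually independent. Put $Z(t)=\sum_{n=1}^{N_1(t)}U_n-\sum_{m=1}^{N_2(t)}D_m$ and let $X$ be the B$\Gamma$-OU process, i.e. a solution of $dX(t)=-kX(t)\,dt+dZ(t)$, $X(0)=X_0$ (that is, almost surely $X(t)=X_0-k\int_0^tX(u)\,du+Z(t)$ for all $t\ge0$). For $0<a<1$ and $\alpha>0$ put $b_n(a,\alpha)=\binom{\alpha+n-1}{n}a^{\alpha}(1-a)^n$. For integers $n,m\ge1$ and $\beta,\beta'>0$ let $f_{n,\beta}(x)=\frac{\beta^n x^{n-1}}{(n-1)!}e^{-\beta x}\mathbf 1_{x\ge0}$ be the Erlang density (for $n=1$, $x^{0}=1$ also at $x=0$), and let $$f_{n,m,\beta,\beta'}(x)=\begin{cases}\dfrac{\beta'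 e^{\beta' x}}{(n-1)!}\Big(\dfrac{\beta}{\beta+\beta'}\Big)^{n}\displaystyle\sum_{i=0}^{m-1}\frac{(n+m-i-2)!}{i!\,(m-i-1)!}\Big(\dfrac{\beta'}{\beta+\beta'}\Big)^{m-i-1}(-\beta' x)^i,&x<0,\\[2ex]\dfrac{\beta e^{-\beta x}}{(m-1)!}\Big(\dfrac{\beta'}{\beta+\beta'}\Big)^{m}\displaystyle\sum_{j=0}^{n-1}\frac{(n+m-j-2)!}{j!\,(n-j-1)!}\Big(\dfrac{\beta}{\beta+\beta'}\Big)^{n-j-1}(\beta x)^j,&x\ge0.\end{cases}$$ Let $g_a$ be the generalized density (with an atom at the origin, $\delta$ being the Dirac delta) $$g_a(x,\alpha_1,\beta_1,\alpha_2,\beta_2)=a^{\alpha_1+\alpha_2}\delta(x)+a^{\alpha_2}\sum_{n\ge1}b_n(a,\alpha_1)f_{n,\beta_1/a}(x)+a^{\alpha_1}\sum_{m\ge1}b_m(a,\alpha_2)f_{m,\beta_2/a}(-x)+\sum_{n,m\ge1}b_n(a,\alpha_1)b_m(a,\alpha_2)f_{n,m,\beta_1/a,\beta_2/a}(x).$$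 Then for all $s\ge0$ and $t>0$ the transition density of $X$ is $$p(x,t+s\mid y,s)=g_a\Big(x-ay,\tfrac{\lambda_1}{k},\beta_1,\tfrac{\lambda_2}{k},\beta_2\Big),\qquad a=e^{-kt}.$$ That is, the three series above converge for every $x$, and the probability measure $p(x,t+s\mid y,s)\,dx$, consisting of the atom of mass $a^{(\lambda_1+\lambda_2)/k}$ at $x=ay$ and of the absolutely continuous part of $g_a(x-ay,\dots)\,dx$, is: (i) for every $y\in\mathbb R$, the law at time $t+s$ of any solution of the equation driven by $Z$ on $[s,\infty)$ with value $y$ at time $s$; (ii) for almost every $y$ with respect to the law of $X(s)$, the conditional law of $X(t+s)$ given $X(s)=y$; (iii) with $y=X(s)$, the conditional law of $X(t+s)$ given $(X(u))_{0\le u\le s}$. -/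

import Mathlib

open MeasureTheory ProbabilityTheory Set
open scoped NNReal ENNReal Nat

/-- `N` is a (homogeneous) Poisson process of intensity `r` under `P`: it starts at `0`, its paths
are nondecreasing and right-continuous, its increments are independent, and the increment over an
interval of length `h` has the Poisson law of mean `r * h`. -/
structure IsPoissonProcess {Ω : Type*} [MeasurableSpace Ω] (P : Measure Ω) (r : ℝ)
    (N : ℝ≥0 → Ω → ℕ) : Prop where
  measurable : ∀ t, Measurable (N t)
  zero : ∀ᵐ ω ∂P, N 0 ω = 0
  paths : ∀ᵐ ω ∂P, Monotone (fun t => N t ω) ∧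
    ∀ t, ContinuousWithinAt (fun u => N u ω) (Ici t) t
  indep : HasIndepIncrements N P
  law : ∀ s h : ℝ≥0,
    HasLaw (fun ω => N (s + h) ω - N s ω) (poissonMeasure (r.toNNReal * h)) P

/-- The difference of two sums of jumps
`Z(t) = ∑_{n < N₁(t)} U n - ∑_{m < N₂(t)} D m`. -/
noncomputable def bilateralCompoundSum {Ω : Type*} (N₁ : ℝ≥0 → Ω → ℕ) (U : ℕ → Ω → ℝ)
    (N₂ : ℝ≥0 → Ω → ℕ) (D : ℕ → Ω → ℝ) (t : ℝ≥0) (ω : Ω) : ℝ :=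
  ∑ n ∈ Finset.range (N₁ t ω), U n ω - ∑ m ∈ Finset.range (N₂ t ω), D m ω

/-- The initial value `X₀` together with the data of two independent compound Poisson processes with
exponential jumps: `N₁`, `N₂` are Poisson processes of intensities `l₁`, `l₂`, the jumps `U n` are
i.i.d. exponential of rate `β₁`, the jumps `D m` are i.i.d. exponential of rate `β₂`, and the five
objects `X₀`, `N₁`, `U`, `N₂`, `D` are mutually independent. -/
structure IsBilateralExpDriver {Ω : Type*} [MeasurableSpace Ω] (P : Measure Ω)
    (l₁ β₁ l₂ β₂ : ℝ) (X₀ : Ω → ℝ) (N₁ : ℝ≥0 → Ω → ℕ) (U : ℕ → Ω → ℝ)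
    (N₂ : ℝ≥0 → Ω → ℕ) (D : ℕ → Ω → ℝ) : Prop where
  init : Measurable X₀
  poisson_up : IsPoissonProcess P l₁ N₁
  poisson_down : IsPoissonProcess P l₂ N₂
  measurable_up : ∀ n, Measurable (U n)
  measurable_down : ∀ m, Measurable (D m)
  law_up : ∀ n, HasLaw (U n) (expMeasure β₁) P
  law_down : ∀ m, HasLaw (D m) (expMeasure β₂) P
  indep_up : iIndepFun U P
  indep_down : iIndepFun D P
  indep : iIndep
    ![MeasurableSpace.comap X₀ inferInstance,
      ⨆ t, MeasurableSpace.comap (N₁ t) inferInstance,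
      ⨆ n, MeasurableSpace.comap (U n) inferInstance,
      ⨆ t, MeasurableSpace.comap (N₂ t) inferInstance,
      ⨆ m, MeasurableSpace.comap (D m) inferInstance] P

/-- `X` solves `dX(t) = -k X(t) dt + dZ(t)` for `t ≥ s` with `X(s) = ξ`: almost surely, for all
`t ≥ s`, `X(t) = ξ - k ∫_s^t X(u) du + Z(t) - Z(s)`. -/
structure IsOUSolution {Ω : Type*} [MeasurableSpace Ω] (P : Measure Ω) (k : ℝ)
    (Z : ℝ≥0 → Ω → ℝ) (s : ℝ≥0) (ξ : Ω → ℝ) (X : ℝ≥0 → Ω → ℝ) : Prop where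
  measurable : ∀ t, s ≤ t → Measurable (X t)
  eqn : ∀ᵐ ω ∂P, ∀ t, s ≤ t →
    IntervalIntegrable (fun u : ℝ => X u.toNNReal ω) volume s t ∧
    X t ω = ξ ω - k * (∫ u in (s : ℝ)..t, X u.toNNReal ω) + (Z t ω - Z s ω)

/-- The Polya (negative binomial) weight `b_n(a, α) = binom(α + n - 1, n) a^α (1 - a)^n`. -/
noncomputable def polyaWeight (a α : ℝ) (n : ℕ) : ℝ :=
  Ring.choose (α + n - 1) n * a ^ α * (1 - a) ^ n

/-- The density of `E_u - E_d` for independent Erlang variables `E_u` of shape `n` and rate `β₁`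
and `E_d` of shape `m` and rate `β₂` (for `n, m ≥ 1`), in closed form. -/
noncomputable def erlangDiffPDF (n m : ℕ) (β₁ β₂ x : ℝ) : ℝ :=
  if x < 0 then
    β₂ * Real.exp (β₂ * x) / ((n - 1)! : ℝ) * (β₁ / (β₁ + β₂)) ^ n *
      ∑ i ∈ Finset.range m, ((n + m - i - 2)! : ℝ) / ((i ! : ℝ) * ((m - i - 1)! : ℝ)) *
        (β₂ / (β₁ + β₂)) ^ (m - i - 1) * (-(β₂ * x)) ^ i
  else
    β₁ * Real.exp (-(β₁ * x)) / ((m - 1)! : ℝ) * (β₂ / (β₁ + β₂)) ^ m *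
      ∑ j ∈ Finset.range n, ((n + m - j - 2)! : ℝ) / ((j ! : ℝ) * ((n - j - 1)! : ℝ)) *
        (β₁ / (β₁ + β₂)) ^ (n - j - 1) * (β₁ * x) ^ j

/-- The `n`-th term (Erlang shape `n + 1`) of the one-sided series of `g_a` on the upward side. -/
noncomputable def upTerm (a α₁ β₁ α₂ x : ℝ) (n : ℕ) : ℝ :=
  polyaWeight a α₁ (n + 1) * a ^ α₂ * gammaPDFReal ((n + 1 : ℕ) : ℝ) (β₁ / a) x

/-- The `m`-th term (Erlang shape `m + 1`) of the one-sided series of `g_a` on the downward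
side. -/
noncomputable def downTerm (a α₁ α₂ β₂ x : ℝ) (m : ℕ) : ℝ :=
  a ^ α₁ * polyaWeight a α₂ (m + 1) * gammaPDFReal ((m + 1 : ℕ) : ℝ) (β₂ / a) (-x)

/-- The `(n, m)`-th term (Erlang shapes `n + 1` and `m + 1`) of the double series of `g_a`. -/
noncomputable def bothTerm (a α₁ β₁ α₂ β₂ x : ℝ) (p : ℕ × ℕ) : ℝ :=
  polyaWeight a α₁ (p.1 + 1) * polyaWeight a α₂ (p.2 + 1) *
    erlangDiffPDF (p.1 + 1) (p.2 + 1) (β₁ / a) (β₂ / a) x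

/-- The absolutely continuous part of the generalized density `g_a(x, α₁, β₁, α₂, β₂)`. -/
noncomputable def remainderDensity (a α₁ β₁ α₂ β₂ x : ℝ) : ℝ :=
  ∑' n, upTerm a α₁ β₁ α₂ x n + ∑' m, downTerm a α₁ α₂ β₂ x m +
    ∑' p, bothTerm a α₁ β₁ α₂ β₂ x p

/-- The measure with generalized density `x ↦ g_a(x - c, α₁, β₁, α₂, β₂)`, where
`g_a(x) = a^(α₁ + α₂) δ(x) + remainderDensity x`. -/
noncomputable def remainderMeasureAt (a α₁ β₁ α₂ β₂ c : ℝ) : Measure ℝ :=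
  ENNReal.ofReal (a ^ (α₁ + α₂)) • Measure.dirac c +
    volume.withDensity (fun x => ENNReal.ofReal (remainderDensity a α₁ β₁ α₂ β₂ (x - c)))

/-! Variation of constants gives `X (s + t) = a * X s + I`, where `I` is the integral of `exp (-k (s
+ t - u))` against `dZ(u)` over `[s, s + t]`. It must be shown that `I` is independent of the past
and that its law is `remainderMeasureAt` at `0`; translation by `a * y` then gives the transition
law and the Markov property.

No stochastic integral is needed: along almost every path `I` is a limit of Riemann–Stieltjes sums
over uniform grids (`tendsto_sum_exp_mul_increment`). Each sum is a weighted sum of increments of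
`Z`, and every increment is independent of what precedes it (`indep_compound_increment`): given `N s
= n`, the past involves only the first `n` jumps, the increment involves only later ones, and its
law does not depend on `n`.

One side of rate `l` and jump parameter `β` therefore contributes a product of compound Poisson
characteristic functions, that is, the exponential of a Riemann sum. In the limit the exponent is
the integral of `l (β / (β - i e(u)) - 1)` with `e(u) = ξ exp (-k (s + t - u))`. Since `e' = k e`,
this has a logarithm as antiderivative, and the result is `((β - i a ξ) / (β - i ξ)) ^ (l / k)`
(`integral_exp_ornsteinUhlenbeck_exponent`).

The binomial series yields the same function: the Polya weights have generating function `(a / (1 -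
(1 - a) z)) ^ α`, and `z` is to be replaced by the characteristic function of the exponential law of
rate `β / a` (`hasSum_polyaWeight_mul_charFun`). So `I` is distributed as the difference of two
independent Polya mixtures of Erlang variables. Splitting the double mixture according to which
shapes vanish produces the atom and the three series of `g_a` (`remainderMeasureAt_zero`). -/

section

/-! ### Erlang densities and the density of a difference of Erlang variables -/

theorem gammaPDFReal_natCast_succ (n : ℕ) (r x : ℝ) :
    gammaPDFReal ((n + 1 : ℕ) : ℝ) r x =
      if 0 ≤ x then r ^ (n + 1) / n ! * x ^ n * Real.exp (-(r * x)) else 0 := by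
  unfold gammaPDFReal
  rw [Real.rpow_natCast]
  have h : ((n + 1 : ℕ) : ℝ) - 1 = n := by push_cast; ring
  rw [h, Real.rpow_natCast]
  have h2 : Real.Gamma ((n + 1 : ℕ) : ℝ) = n ! := by
    push_cast; exact Real.Gamma_nat_eq_factorial n
  rw [h2]

/-- A single term of the exponential series is at most its sum. The bound is uniform in the shape,
so the summable Polya weights dominate the series of `g_a` at every point. -/
theorem gammaPDFReal_natCast_succ_le (n : ℕ) {r : ℝ} (hr : 0 < r) (x : ℝ) :
    gammaPDFReal ((n + 1 : ℕ) : ℝ) r x ≤ r := by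
  rw [gammaPDFReal_natCast_succ]
  split_ifs with h
  · have h1 : (r * x) ^ n / n ! ≤ Real.exp (r * x) :=
      Real.pow_div_factorial_le_exp _ (by positivity) n
    calc r ^ (n + 1) / n ! * x ^ n * Real.exp (-(r * x))
        = r * ((r * x) ^ n / n ! * Real.exp (-(r * x))) := by rw [mul_pow]; ring
      _ ≤ r * (Real.exp (r * x) * Real.exp (-(r * x))) := by gcongr
      _ = r := by rw [← Real.exp_add]; simp
  · exact hr.le

theorem integral_pow_mul_cexp_neg_mul_Ioi (n : ℕ) {w : ℂ} (hw : 0 < w.re) :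
    ∫ x in Ioi (0 : ℝ), (x : ℂ) ^ n * Complex.exp (-(w * x)) = n ! / w ^ (n + 1) := by
  have hw0 : w ≠ 0 := fun h => by simp [h] at hw
  have hnorm : ∀ (n : ℕ) (x : ℝ), 0 ≤ x → ‖(x : ℂ) ^ n * Complex.exp (-(w * x))‖
      = x ^ n * Real.exp (-(w.re * x)) := by
    intro n x hx
    rw [norm_mul, norm_pow, Complex.norm_real, Complex.norm_exp, Real.norm_of_nonneg hx]
    simp
  have hint : ∀ n : ℕ, IntegrableOn (fun x : ℝ => (x : ℂ) ^ n * Complex.exp (-(w * x)))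
      (Ioi 0) := by
    intro n
    have h := integrableOn_rpow_mul_exp_neg_mul_rpow (s := n) (p := 1) (b := w.re)
      (by linarith [(Nat.cast_nonneg n : (0 : ℝ) ≤ n)]) one_pos hw
    refine Integrable.mono' h (Continuous.aestronglyMeasurable (by fun_prop)) ?_
    refine (ae_restrict_iff' measurableSet_Ioi).2 (ae_of_all _ fun x hx => ?_)
    rw [hnorm n x (le_of_lt hx)]
    simp
  induction n with
  | zero =>
    have h := integral_exp_mul_complex_Ioi (a := -w) (by simpa using hw) 0
    simpa [neg_mul] using h
  | succ n ih =>
    -- Integration by parts in primitive form: the derivative combines the integrands of degrees `n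
    -- + 1` and `n`, while the primitive vanishes at `0` and at infinity.
    have hderiv : ∀ x ∈ Ici (0 : ℝ), HasDerivAt
        (fun x : ℝ => -((x : ℂ) ^ (n + 1) * Complex.exp (-(w * x)) / w))
        ((x : ℂ) ^ (n + 1) * Complex.exp (-(w * x))
          - (n + 1) / w * ((x : ℂ) ^ n * Complex.exp (-(w * x)))) x := by
      intro x _
      have h1 : HasDerivAt (fun z : ℂ => -(z ^ (n + 1) * Complex.exp (-(w * z)) / w))
          ((x : ℂ) ^ (n + 1) * Complex.exp (-(w * x))
          - (n + 1) / w * ((x : ℂ) ^ n * Complex.exp (-(w * x)))) (x : ℂ) := by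
        have h2 : HasDerivAt (fun z : ℂ => -(w * z)) (-w) (x : ℂ) := by
          simpa using! ((hasDerivAt_id (x : ℂ)).const_mul w).neg
        refine (((hasDerivAt_pow (n + 1) (x : ℂ)).mul h2.cexp).div_const w).neg.congr_deriv ?_
        push_cast
        field_simp
        simp
        ring
      exact h1.comp_ofReal
    have hlim : Filter.Tendsto (fun x : ℝ => -((x : ℂ) ^ (n + 1) * Complex.exp (-(w * x)) / w))
        Filter.atTop (nhds 0) := by
      have h1 : Filter.Tendsto (fun x : ℝ => x ^ (n + 1) * Real.exp (-(w.re * x))) Filter.atTop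
          (nhds 0) := by
        have := tendsto_rpow_mul_exp_neg_mul_atTop_nhds_zero (n + 1 : ℕ) w.re hw
        simpa only [Real.rpow_natCast, neg_mul] using this
      have h2 : Filter.Tendsto (fun x : ℝ => (x : ℂ) ^ (n + 1) * Complex.exp (-(w * x)))
          Filter.atTop (nhds 0) := by
        rw [tendsto_zero_iff_norm_tendsto_zero]
        refine h1.congr' ?_
        filter_upwards [Filter.eventually_ge_atTop 0] with x hx using (hnorm _ x hx).symm
      simpa using (h2.div_const w).neg
    have h := integral_Ioi_of_hasDerivAt_of_tendsto' hderiv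
      ((hint (n + 1)).sub ((hint n).const_mul _)) hlim
    rw [integral_sub (hint (n + 1)) ((hint n).const_mul _), integral_const_mul, ih] at h
    simp only [Complex.ofReal_zero, ne_eq, Nat.add_eq_zero_iff, one_ne_zero, and_false,
      not_false_eq_true, zero_pow, zero_mul, zero_div, neg_zero, sub_zero] at h
    rw [sub_eq_zero.1 h, Nat.factorial_succ]
    push_cast
    field_simp
    ring

theorem charFun_gammaMeasure_natCast_succ (n : ℕ) {r : ℝ} (hr : 0 < r) (t : ℝ) :
    charFun (gammaMeasure ((n + 1 : ℕ) : ℝ) r) t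
      = ((r : ℂ) / (r - t * Complex.I)) ^ (n + 1) := by
  have hre : 0 < ((r : ℂ) - t * Complex.I).re := by simpa using hr
  have key := integral_pow_mul_cexp_neg_mul_Ioi n hre
  rw [charFun_apply_real, gammaMeasure]
  unfold gammaPDF
  rw [integral_withDensity_eq_integral_toReal_smul
    (measurable_gammaPDFReal _ _).ennreal_ofReal (by simp)]
  have h1 : ∀ x : ℝ, (ENNReal.ofReal (gammaPDFReal ((n + 1 : ℕ) : ℝ) r x)).toReal
      = gammaPDFReal ((n + 1 : ℕ) : ℝ) r x := fun x =>
    ENNReal.toReal_ofReal (gammaPDFReal_nonneg (by positivity) hr x)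
  simp_rw [h1]
  rw [← setIntegral_eq_integral_of_forall_compl_eq_zero (s := Ici 0), integral_Ici_eq_integral_Ioi,
    setIntegral_congr_fun measurableSet_Ioi (g := fun x : ℝ => ((r : ℂ) ^ (n + 1) / n !) *
      ((x : ℂ) ^ n * Complex.exp (-((r - t * Complex.I) * x)))), integral_const_mul, key, div_pow]
  · have : (n ! : ℂ) ≠ 0 := by exact_mod_cast n.factorial_ne_zero
    field_simp
  · intro x hx
    have hx' : (0 : ℝ) ≤ x := le_of_lt hx
    simp only [gammaPDFReal_natCast_succ, if_pos hx', Complex.real_smul]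
    push_cast
    rw [mul_assoc, ← Complex.exp_add, mul_assoc]
    ring_nf
  · intro x hx
    have hx' : ¬ (0 : ℝ) ≤ x := hx
    simp only [gammaPDFReal_natCast_succ, if_neg hx', zero_smul]

/-- Expanding `(u + x) ^ n` by the binomial theorem turns each term, as a function of `u`, into a
multiple of an Erlang density of rate `b + c`. Integrating in `u` then leaves only the coefficients,
which are those of `erlangDiffPDF`. -/
theorem gammaPDFReal_mul_gammaPDFReal (n m : ℕ) {b c x : ℝ} (hb : 0 < b) (hc : 0 < c)
    (hx : 0 ≤ x) (u : ℝ) :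
    gammaPDFReal ((n + 1 : ℕ) : ℝ) b (u + x) * gammaPDFReal ((m + 1 : ℕ) : ℝ) c u =
      b * Real.exp (-(b * x)) / (m ! : ℝ) * (c / (b + c)) ^ (m + 1) *
        ∑ j ∈ Finset.range (n + 1),
        (((n + 1 + (m + 1) - j - 2)! : ℝ) / ((j ! : ℝ) * ((n + 1 - j - 1)! : ℝ)) *
        (b / (b + c)) ^ (n + 1 - j - 1) * (b * x) ^ j) *
        gammaPDFReal ((n - j + m + 1 : ℕ) : ℝ) (b + c) u := by
  simp_rw [gammaPDFReal_natCast_succ]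
  by_cases hu : 0 ≤ u
  · rw [if_pos hu, if_pos (by positivity)]
    simp_rw [if_pos hu]
    rw [add_comm u x, add_pow, Finset.mul_sum, Finset.sum_mul, Finset.sum_mul, Finset.mul_sum]
    refine Finset.sum_congr rfl fun j hj => ?_
    -- Writing `n = j + i` removes every truncated subtraction.
    obtain ⟨i, rfl⟩ : ∃ i, n = j + i :=
      ⟨n - j, by have := Finset.mem_range.1 hj; omega⟩
    have e1 : j + i + 1 + (m + 1) - j - 2 = i + m := by omega
    have e2 : j + i + 1 - j - 1 = i := by omega
    have e3 : j + i - j = i := by omega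
    rw [e1, e2, e3, Nat.cast_add_choose ℝ]
    have hexp : Real.exp (-((b + c) * u)) = Real.exp (-(b * u)) * Real.exp (-(c * u)) := by
      rw [← Real.exp_add]; ring_nf
    have hexp2 : Real.exp (-(b * (x + u))) = Real.exp (-(b * x)) * Real.exp (-(b * u)) := by
      rw [← Real.exp_add]; ring_nf
    rw [hexp, hexp2, mul_pow, div_pow, div_pow]
    have h1 : (b + c) ≠ 0 := by positivity
    field_simp
    ring
  · simp [hu]

theorem lintegral_gammaPDF_mul_gammaPDF (n m : ℕ) {b c x : ℝ} (hb : 0 < b) (hc : 0 < c)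
    (hx : 0 ≤ x) :
    ∫⁻ u, gammaPDF ((n + 1 : ℕ) : ℝ) b (u + x) * gammaPDF ((m + 1 : ℕ) : ℝ) c u =
      ENNReal.ofReal (erlangDiffPDF (n + 1) (m + 1) b c x) := by
  have hs : 0 < b + c := by positivity
  have h : ∀ u, gammaPDF ((n + 1 : ℕ) : ℝ) b (u + x) * gammaPDF ((m + 1 : ℕ) : ℝ) c u =
      ENNReal.ofReal (b * Real.exp (-(b * x)) / (m ! : ℝ) * (c / (b + c)) ^ (m + 1)) *
        ∑ j ∈ Finset.range (n + 1), ENNReal.ofReal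
        (((n + 1 + (m + 1) - j - 2)! : ℝ) / ((j ! : ℝ) * ((n + 1 - j - 1)! : ℝ)) *
        (b / (b + c)) ^ (n + 1 - j - 1) * (b * x) ^ j) *
        gammaPDF ((n - j + m + 1 : ℕ) : ℝ) (b + c) u := by
    intro u
    have hg : ∀ j : ℕ, 0 ≤ gammaPDFReal ((n - j + m + 1 : ℕ) : ℝ) (b + c) u := fun j =>
      gammaPDFReal_nonneg (by positivity) hs u
    unfold gammaPDF
    rw [← ENNReal.ofReal_mul (gammaPDFReal_nonneg (by positivity) hb _),
      gammaPDFReal_mul_gammaPDFReal n m hb hc hx u, ENNReal.ofReal_mul (by positivity),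
      ENNReal.ofReal_sum_of_nonneg fun j _ => mul_nonneg (by positivity) (hg j)]
    congr 1
    refine Finset.sum_congr rfl fun j _ => ENNReal.ofReal_mul (by positivity)
  have hm : ∀ a r : ℝ, Measurable (gammaPDF a r) := fun a r =>
    (measurable_gammaPDFReal a r).ennreal_ofReal
  simp_rw [h]
  rw [lintegral_const_mul _ (Finset.measurable_fun_sum _ fun j _ => (hm _ _).const_mul _),
    lintegral_finsetSum _ fun j _ => (hm _ _).const_mul _]
  simp_rw [lintegral_const_mul _ (hm _ _)]
  rw [erlangDiffPDF, if_neg (not_lt.2 hx), ENNReal.ofReal_mul (q := Finset.sum _ _) (by positivity),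
    ENNReal.ofReal_sum_of_nonneg fun j _ => by positivity, Nat.add_sub_cancel]
  congr 1
  refine Finset.sum_congr rfl fun j _ => ?_
  rw [lintegral_gammaPDF_eq_one (by positivity) hs, mul_one]

/-- Reflection exchanges the two Erlang variables, so only `0 ≤ x` has to be computed. -/
theorem erlangDiffPDF_of_neg (n m : ℕ) (b c : ℝ) {x : ℝ} (hx : x < 0) :
    erlangDiffPDF n m b c x = erlangDiffPDF m n c b (-x) := by
  rw [erlangDiffPDF, erlangDiffPDF, if_pos hx, if_neg (by linarith), add_comm c b, add_comm m n]
  simp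

theorem lconvolution_gammaPDF (n m : ℕ) {b c : ℝ} (hb : 0 < b) (hc : 0 < c) (x : ℝ) :
    (gammaPDF ((n + 1 : ℕ) : ℝ) b ⋆ₗ fun y => gammaPDF ((m + 1 : ℕ) : ℝ) c (-y)) x =
      ENNReal.ofReal (erlangDiffPDF (n + 1) (m + 1) b c x) := by
  rw [lconvolution_def]
  simp only [neg_add, neg_neg]
  rcases le_or_gt 0 x with hx | hx
  · rw [← lintegral_gammaPDF_mul_gammaPDF n m hb hc hx,
      ← lintegral_add_right_eq_self _ x]
    simp
  · rw [erlangDiffPDF_of_neg _ _ _ _ hx,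
      ← lintegral_gammaPDF_mul_gammaPDF m n hc hb (by linarith)]
    simp_rw [mul_comm]

theorem erlangDiffPDF_nonneg (n m : ℕ) {b c : ℝ} (hb : 0 < b) (hc : 0 < c) (x : ℝ) :
    0 ≤ erlangDiffPDF (n + 1) (m + 1) b c x := by
  unfold erlangDiffPDF
  split_ifs with h
  · have : 0 ≤ -(c * x) := by nlinarith
    positivity
  · have : 0 ≤ x := not_lt.1 h
    positivity

/-- Convolving a probability density with a function bounded by `c` keeps the bound `c`. -/
theorem erlangDiffPDF_le (n m : ℕ) {b c : ℝ} (hb : 0 < b) (hc : 0 < c) (x : ℝ) :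
    erlangDiffPDF (n + 1) (m + 1) b c x ≤ c := by
  rw [← ENNReal.ofReal_le_ofReal_iff hc.le, ← lconvolution_gammaPDF n m hb hc x, lconvolution_def]
  calc _ ≤ ∫⁻ y, gammaPDF ((n + 1 : ℕ) : ℝ) b y * ENNReal.ofReal c := by
        refine lintegral_mono fun y => ?_
        gcongr
        exact ENNReal.ofReal_le_ofReal (gammaPDFReal_natCast_succ_le m hc _)
    _ = ENNReal.ofReal c := by
        rw [lintegral_mul_const _ (show Measurable (gammaPDF _ _) from
            (measurable_gammaPDFReal _ _).ennreal_ofReal),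
          lintegral_gammaPDF_eq_one (by positivity) hb, one_mul]

theorem measurable_erlangDiffPDF (n m : ℕ) (b c : ℝ) : Measurable (erlangDiffPDF n m b c) := by
  unfold erlangDiffPDF
  refine Measurable.ite measurableSet_Iio ?_ ?_ <;> fun_prop

theorem map_neg_withDensity (f : ℝ → ℝ≥0∞) :
    (volume.withDensity f).map (fun x => -x) = volume.withDensity fun x => f (-x) := by
  ext s hs
  rw [Measure.map_apply measurable_neg hs, withDensity_apply _ hs,
    withDensity_apply _ (measurable_neg hs), ← lintegral_indicator hs,
    ← lintegral_indicator (measurable_neg hs), ← lintegral_neg_eq_self]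
  refine lintegral_congr fun x => ?_
  have hx : -x ∈ (fun x : ℝ => -x) ⁻¹' s ↔ x ∈ s := by rw [mem_preimage, neg_neg]
  by_cases h : x ∈ s
  · exact (indicator_of_mem (hx.2 h) _).trans (indicator_of_mem h (fun x => f (-x))).symm
  · exact (indicator_of_notMem (mt hx.1 h) _).trans
      (indicator_of_notMem h (fun x => f (-x))).symm

theorem gammaMeasure_conv_map_neg_gammaMeasure (n m : ℕ) {b c : ℝ} (hb : 0 < b) (hc : 0 < c) :
    gammaMeasure ((n + 1 : ℕ) : ℝ) b ∗ (gammaMeasure ((m + 1 : ℕ) : ℝ) c).map (fun x => -x) =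
      volume.withDensity
        fun x => ENNReal.ofReal (erlangDiffPDF (n + 1) (m + 1) b c x) := by
  have hm : ∀ a r : ℝ, Measurable (gammaPDF a r) := fun a r =>
    (measurable_gammaPDFReal a r).ennreal_ofReal
  rw [gammaMeasure, gammaMeasure, map_neg_withDensity,
    conv_withDensity_eq_lconvolution (hm _ _) (show Measurable fun x => gammaPDF ((m + 1 : ℕ) : ℝ) c (-x) from
      (hm _ _).comp measurable_neg)]
  congr 1
  ext x
  exact lconvolution_gammaPDF n m hb hc x

end

/-! ### Polya weights and the mixture of Erlang differences -/

section

theorem polyaWeight_zero (a α : ℝ) : polyaWeight a α 0 = a ^ α := by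
  simp [polyaWeight]

theorem polyaWeight_nonneg {a α : ℝ} (ha : 0 ≤ a) (ha1 : a ≤ 1) (hα : 0 < α) (n : ℕ) :
    0 ≤ polyaWeight a α n := by
  -- Multiplied by `n!`, this coefficient is the rising factorial `α (α + 1) ⋯ (α + n - 1)`, which
  -- is positive.
  have h : 0 ≤ Ring.choose (α + n - 1) n := by
    have h1 := Ring.factorial_nsmul_multichoose_eq_ascPochhammer α n
    rw [Polynomial.ascPochhammer_smeval_eq_eval, Ring.multichoose_eq, nsmul_eq_mul] at h1
    have h2 : 0 < (ascPochhammer ℝ n).eval α := ascPochhammer_pos n α hα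
    rw [← h1] at h2
    exact (pos_of_mul_pos_right h2 (by positivity)).le
  have h2 : 0 ≤ 1 - a := by linarith
  unfold polyaWeight
  positivity

/-- The binomial series of `(1 - w) ^ (-α)` at `w = (1 - a) z`; since `0 < a`, the point `w` stays
inside the open unit disc even when `‖z‖ = 1`. -/
theorem hasSum_polyaWeight_mul_pow {a α : ℝ} (ha : 0 < a) (ha1 : a ≤ 1) {z : ℂ}
    (hz : ‖z‖ ≤ 1) :
    HasSum (fun n => (polyaWeight a α n : ℂ) * z ^ n)
      ((a : ℂ) ^ (α : ℂ) / (1 - (1 - a) * z) ^ (α : ℂ)) := by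
  have hlt : ‖(1 - (a : ℂ)) * z‖ < 1 := by
    have h1 : ‖(1 - (a : ℂ))‖ = 1 - a := by
      rw [← Complex.ofReal_one, ← Complex.ofReal_sub, Complex.norm_real,
        Real.norm_of_nonneg (by linarith)]
    rw [norm_mul, h1]
    nlinarith [norm_nonneg z]
  have h := (Complex.one_div_one_sub_cpow_hasFPowerSeriesOnBall_zero (α : ℂ)).hasSum
    (y := (1 - (a : ℂ)) * z) (by
      rw [← ENNReal.ofReal_one, Metric.eball_ofReal]
      simpa using hlt)
  simp only [FormalMultilinearSeries.ofScalars_apply_eq, zero_add] at h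
  have e : (fun n => (polyaWeight a α n : ℂ) * z ^ n) = fun n : ℕ =>
      (a : ℂ) ^ (α : ℂ) * Ring.choose ((α : ℂ) + n - 1) n • ((1 - a) * z) ^ n := by
    ext n
    unfold polyaWeight
    push_cast [Complex.ofReal_cpow ha.le, Complex.ofReal_choose]
    rw [mul_pow, smul_eq_mul]
    ring
  rw [e, ← mul_one_div]
  simpa only [smul_eq_mul, mul_assoc] using h.mul_left ((a : ℂ) ^ (α : ℂ))

theorem summable_polyaWeight {a α : ℝ} (ha : 0 < a) (ha1 : a ≤ 1) :
    Summable (polyaWeight a α) := by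
  have h := (hasSum_polyaWeight_mul_pow (α := α) ha ha1 (z := 1) (by simp)).summable
  simpa [Complex.summable_ofReal] using h

theorem hasSum_polyaWeight {a α : ℝ} (ha : 0 < a) (ha1 : a ≤ 1) :
    HasSum (polyaWeight a α) 1 := by
  have h := hasSum_polyaWeight_mul_pow (α := α) ha ha1 (z := 1) (by simp)
  have h0 : (a : ℂ) ^ (α : ℂ) ≠ 0 := by simp [Complex.cpow_eq_zero_iff, ha.ne']
  rw [mul_one, sub_sub_cancel, div_self h0] at h
  rw [← Complex.hasSum_ofReal]
  simpa using h

section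
variable {a α₁ β₁ α₂ β₂ : ℝ}

theorem summable_upTerm (ha : 0 < a) (ha1 : a ≤ 1) (hα₁ : 0 < α₁) (hβ₁ : 0 < β₁) (x : ℝ) :
    Summable (upTerm a α₁ β₁ α₂ x) := by
  refine Summable.of_nonneg_of_le (fun n => ?_) (fun n => ?_)
    ((((summable_polyaWeight ha ha1 (α := α₁)).comp_injective
      (add_left_injective 1)).mul_right (a ^ α₂)).mul_right (β₁ / a))
  · have := polyaWeight_nonneg ha.le ha1 hα₁ (n + 1)
    have := gammaPDFReal_nonneg (a := ((n + 1 : ℕ) : ℝ)) (r := β₁ / a) (by positivity)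
      (by positivity) x
    unfold upTerm
    positivity
  · have := polyaWeight_nonneg ha.le ha1 hα₁ (n + 1)
    exact mul_le_mul_of_nonneg_left (gammaPDFReal_natCast_succ_le n (by positivity) x)
      (by positivity)

theorem upTerm_nonneg (ha : 0 < a) (ha1 : a ≤ 1) (hα₁ : 0 < α₁) (hβ₁ : 0 < β₁) (x : ℝ) (n : ℕ) :
    0 ≤ upTerm a α₁ β₁ α₂ x n := by
  have := polyaWeight_nonneg ha.le ha1 hα₁ (n + 1)
  have := gammaPDFReal_nonneg (a := ((n + 1 : ℕ) : ℝ)) (r := β₁ / a) (by positivity)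
    (by positivity) x
  unfold upTerm
  positivity

theorem downTerm_eq_upTerm (x : ℝ) :
    downTerm a α₁ α₂ β₂ x = upTerm a α₂ β₂ α₁ (-x) := by
  ext n
  simp only [downTerm, upTerm]
  ring

theorem bothTerm_nonneg (ha : 0 < a) (ha1 : a ≤ 1) (hα₁ : 0 < α₁) (hβ₁ : 0 < β₁) (hα₂ : 0 < α₂)
    (hβ₂ : 0 < β₂) (x : ℝ) (p : ℕ × ℕ) : 0 ≤ bothTerm a α₁ β₁ α₂ β₂ x p :=
  mul_nonneg (mul_nonneg (polyaWeight_nonneg ha.le ha1 hα₁ _) (polyaWeight_nonneg ha.le ha1 hα₂ _))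
    (erlangDiffPDF_nonneg _ _ (by positivity) (by positivity) x)

theorem summable_bothTerm (ha : 0 < a) (ha1 : a ≤ 1) (hα₁ : 0 < α₁) (hβ₁ : 0 < β₁) (hα₂ : 0 < α₂)
    (hβ₂ : 0 < β₂) (x : ℝ) : Summable (bothTerm a α₁ β₁ α₂ β₂ x) := by
  have h1 := (summable_polyaWeight ha ha1 (α := α₁)).comp_injective (add_left_injective 1)
  have h2 := (summable_polyaWeight ha ha1 (α := α₂)).comp_injective (add_left_injective 1)
  refine Summable.of_nonneg_of_le (bothTerm_nonneg ha ha1 hα₁ hβ₁ hα₂ hβ₂ x) (fun p => ?_)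
    ((h1.mul_of_nonneg h2 (fun n => polyaWeight_nonneg ha.le ha1 hα₁ _)
      (fun n => polyaWeight_nonneg ha.le ha1 hα₂ _)).mul_right (β₂ / a))
  exact mul_le_mul_of_nonneg_left (erlangDiffPDF_le _ _ (by positivity) (by positivity) x)
    (mul_nonneg (polyaWeight_nonneg ha.le ha1 hα₁ _) (polyaWeight_nonneg ha.le ha1 hα₂ _))

end

/-- The Erlang law of shape `n` and rate `r`, the unit mass at `0` for `n = 0`. -/
noncomputable def erlangMeasure (n : ℕ) (r : ℝ) : Measure ℝ :=
  if n = 0 then Measure.dirac 0 else gammaMeasure (n : ℝ) r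

theorem isProbabilityMeasure_erlangMeasure (n : ℕ) {r : ℝ} (hr : 0 < r) :
    IsProbabilityMeasure (erlangMeasure n r) := by
  unfold erlangMeasure
  split_ifs with h
  · infer_instance
  · exact isProbabilityMeasure_gammaMeasure (by positivity) hr

theorem charFun_erlangMeasure (n : ℕ) {r : ℝ} (hr : 0 < r) (t : ℝ) :
    charFun (erlangMeasure n r) t = ((r : ℂ) / (r - t * Complex.I)) ^ n := by
  cases n with
  | zero => simp [erlangMeasure]
  | succ n => rw [erlangMeasure, if_neg (by simp), charFun_gammaMeasure_natCast_succ n hr]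

/-- The law of the difference of independent Polya mixtures of Erlang variables. -/
noncomputable def polyaErlangMeasure (a α₁ β₁ α₂ β₂ : ℝ) : Measure ℝ :=
  Measure.sum fun p : ℕ × ℕ => ENNReal.ofReal (polyaWeight a α₁ p.1 * polyaWeight a α₂ p.2) •
    (erlangMeasure p.1 (β₁ / a) ∗ (erlangMeasure p.2 (β₂ / a)).map (fun x => -x))

/-- The characteristic function of a Polya mixture of Erlang laws. -/
noncomputable def polyaErlangCharFun (a α β t : ℝ) : ℂ :=
  Complex.exp (α * (Complex.log (β - a * t * Complex.I) - Complex.log (β - t * Complex.I)))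

/-- Both arguments lie strictly between `-π/2` and `π/2`, so their difference stays in the principal
range. -/
theorem log_div_of_re_pos {u v : ℂ} (hu : 0 < u.re) (hv : 0 < v.re) :
    Complex.log (u / v) = Complex.log u - Complex.log v := by
  have hu0 : u ≠ 0 := fun h => by simp [h] at hu
  have hv0 : v ≠ 0 := fun h => by simp [h] at hv
  have h1 := abs_lt.1 (Complex.abs_arg_lt_pi_div_two_iff.2 (Or.inl hu))
  have h2 := abs_lt.1 (Complex.abs_arg_lt_pi_div_two_iff.2 (Or.inl hv))
  have h3 : v.arg ≠ Real.pi := by linarith [h2.2, Real.pi_pos]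
  rw [div_eq_mul_inv, Complex.log_mul hu0 (inv_ne_zero hv0), Complex.log_inv _ h3, sub_eq_add_neg]
  rw [Complex.arg_inv, if_neg h3]
  constructor <;> linarith [h1.1, h1.2, h2.1, h2.2]

theorem hasSum_polyaWeight_mul_charFun {a α β : ℝ} (ha : 0 < a) (ha1 : a ≤ 1) (hβ : 0 < β)
    (t : ℝ) :
    HasSum (fun n => (polyaWeight a α n : ℂ) * charFun (erlangMeasure n (β / a)) t)
      (polyaErlangCharFun a α β t) := by
  have hr : 0 < β / a := by positivity
  -- This quotient is the characteristic function of the Erlang law of shape `1`, hence of norm at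
  -- most one.
  have hz : ‖((β / a : ℝ) : ℂ) / ((β / a : ℝ) - t * Complex.I)‖ ≤ 1 := by
    have := isProbabilityMeasure_erlangMeasure 1 hr
    have h := norm_charFun_le_one (μ := erlangMeasure 1 (β / a)) t
    rwa [charFun_erlangMeasure 1 hr, pow_one] at h
  simp_rw [charFun_erlangMeasure _ hr]
  convert hasSum_polyaWeight_mul_pow (α := α) ha ha1 hz using 1
  have ha0 : (a : ℂ) ≠ 0 := by exact_mod_cast ha.ne'
  have hu : 0 < ((β : ℂ) - t * Complex.I).re := by simpa using hβ
  have hv : 0 < ((β : ℂ) - a * t * Complex.I).re := by simpa using hβ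
  have hu0 : (β : ℂ) - t * Complex.I ≠ 0 := fun h => by simp [h] at hu
  have hv0 : (β : ℂ) - a * t * Complex.I ≠ 0 := fun h => by simp [h] at hv
  -- The factor `a` on the right cancels the `a ^ α` of the Polya weights; the rate `β / a` is what
  -- makes this happen.
  have hq : 1 - (1 - (a : ℂ)) * (((β / a : ℝ) : ℂ) / ((β / a : ℝ) - t * Complex.I)) =
      a * ((β - t * Complex.I) / (β - a * t * Complex.I)) := by
    have h1 : (((β / a : ℝ) : ℂ) - t * Complex.I) = (β - a * t * Complex.I) / a := by
      push_cast; field_simp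
    rw [h1]
    push_cast
    field_simp
    ring
  rw [hq, Complex.cpow_def_of_ne_zero ha0,
    Complex.cpow_def_of_ne_zero (mul_ne_zero ha0 (div_ne_zero hu0 hv0)),
    Complex.log_ofReal_mul ha (div_ne_zero hu0 hv0), log_div_of_re_pos hu hv, ← Complex.exp_sub,
    polyaErlangCharFun, Complex.ofReal_log ha.le]
  ring_nf

theorem summable_norm_polyaWeight_mul_charFun {a α β : ℝ} (ha : 0 < a) (ha1 : a ≤ 1) (hα : 0 < α)
    (hβ : 0 < β) (t : ℝ) : Summable fun n =>
      ‖(polyaWeight a α n : ℂ) * charFun (erlangMeasure n (β / a)) t‖ := by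
  refine Summable.of_nonneg_of_le (fun _ => norm_nonneg _) (fun n => ?_)
    (summable_polyaWeight ha ha1 (α := α))
  have := isProbabilityMeasure_erlangMeasure n (div_pos hβ ha)
  rw [norm_mul, Complex.norm_real, Real.norm_of_nonneg (polyaWeight_nonneg ha.le ha1 hα n)]
  exact mul_le_of_le_one_right (polyaWeight_nonneg ha.le ha1 hα n) (norm_charFun_le_one t)

theorem hasSum_mul_of_summable_norm {f g : ℕ → ℂ} {u v : ℂ} (hu : HasSum f u) (hv : HasSum g v)
    (hf : Summable fun n => ‖f n‖) (hg : Summable fun n => ‖g n‖) :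
    HasSum (fun p : ℕ × ℕ => f p.1 * g p.2) (u * v) :=
  hu.mul hv (summable_mul_of_summable_norm hf hg)

theorem charFun_map_neg (μ : Measure ℝ) (t : ℝ) :
    charFun (μ.map fun x => -x) t = charFun μ (-t) := by
  have h := charFun_map_smul (μ := μ) (-1) t
  simpa using h

theorem integrable_cexp_ofReal_mul_I {Ω : Type*} [MeasurableSpace Ω] {μ : Measure Ω}
    [IsFiniteMeasure μ] {f : Ω → ℝ} (hf : Measurable f) :
    Integrable (fun ω => Complex.exp (f ω * Complex.I)) μ := by
  refine Integrable.of_bound (by fun_prop) 1 (ae_of_all _ fun x => ?_)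
  rw [Complex.norm_exp_ofReal_mul_I]

section
variable {a α₁ β₁ α₂ β₂ : ℝ}

theorem isProbabilityMeasure_polyaErlangMeasure (ha : 0 < a) (ha1 : a ≤ 1) (hα₁ : 0 < α₁)
    (hβ₁ : 0 < β₁) (hα₂ : 0 < α₂) (hβ₂ : 0 < β₂) :
    IsProbabilityMeasure (polyaErlangMeasure a α₁ β₁ α₂ β₂) := by
  have h1 := fun n => isProbabilityMeasure_erlangMeasure n (div_pos hβ₁ ha)
  have h2 := fun n => isProbabilityMeasure_erlangMeasure n (div_pos hβ₂ ha)
  have h3 := fun n => Measure.isProbabilityMeasure_map (μ := erlangMeasure n (β₂ / a))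
    (f := fun x => -x) (by fun_prop)
  constructor
  rw [polyaErlangMeasure, Measure.sum_apply _ MeasurableSet.univ]
  simp only [Measure.smul_apply, measure_univ, smul_eq_mul, mul_one]
  have hs := (hasSum_polyaWeight ha ha1 (α := α₁)).mul (hasSum_polyaWeight ha ha1 (α := α₂))
    ((summable_polyaWeight ha ha1).mul_of_nonneg (summable_polyaWeight ha ha1)
      (fun n => polyaWeight_nonneg ha.le ha1 hα₁ n) (fun n => polyaWeight_nonneg ha.le ha1 hα₂ n))
  rw [← ENNReal.ofReal_tsum_of_nonneg (fun p => mul_nonneg (polyaWeight_nonneg ha.le ha1 hα₁ _)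
    (polyaWeight_nonneg ha.le ha1 hα₂ _)) hs.summable, hs.tsum_eq]
  simp

/-- Each component is a convolution, so its characteristic function splits into a factor in `p.1`
and a factor in `p.2`; absolute convergence then makes the double series a product of two series. -/
theorem charFun_polyaErlangMeasure (ha : 0 < a) (ha1 : a ≤ 1) (hα₁ : 0 < α₁)
    (hβ₁ : 0 < β₁) (hα₂ : 0 < α₂) (hβ₂ : 0 < β₂) (t : ℝ) :
    charFun (polyaErlangMeasure a α₁ β₁ α₂ β₂) t =
      polyaErlangCharFun a α₁ β₁ t * polyaErlangCharFun a α₂ β₂ (-t) := by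
  have h0 := isProbabilityMeasure_polyaErlangMeasure ha ha1 hα₁ hβ₁ hα₂ hβ₂
  have h1 := fun n => isProbabilityMeasure_erlangMeasure n (div_pos hβ₁ ha)
  have h2 := fun n => isProbabilityMeasure_erlangMeasure n (div_pos hβ₂ ha)
  have h3 := fun n => Measure.isProbabilityMeasure_map (μ := erlangMeasure n (β₂ / a))
    (f := fun x => -x) (by fun_prop)
  have hint : Integrable (fun x : ℝ => Complex.exp (t * x * Complex.I))
      (polyaErlangMeasure a α₁ β₁ α₂ β₂) := by
    simpa using integrable_cexp_ofReal_mul_I (μ := polyaErlangMeasure a α₁ β₁ α₂ β₂)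
      (f := fun x => t * x) (by fun_prop)
  have hs := hasSum_integral_measure hint
  rw [← charFun_apply_real] at hs
  have hp := hasSum_mul_of_summable_norm
    (hasSum_polyaWeight_mul_charFun (α := α₁) ha ha1 hβ₁ t)
    (hasSum_polyaWeight_mul_charFun (α := α₂) ha ha1 hβ₂ (-t))
    (summable_norm_polyaWeight_mul_charFun ha ha1 hα₁ hβ₁ t)
    (summable_norm_polyaWeight_mul_charFun ha ha1 hα₂ hβ₂ (-t))
  have e : (fun p : ℕ × ℕ => ∫ x, Complex.exp (t * x * Complex.I)
      ∂(ENNReal.ofReal (polyaWeight a α₁ p.1 * polyaWeight a α₂ p.2) •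
        (erlangMeasure p.1 (β₁ / a) ∗ (erlangMeasure p.2 (β₂ / a)).map (fun x => -x)))) =
      fun p : ℕ × ℕ => (polyaWeight a α₁ p.1 * charFun (erlangMeasure p.1 (β₁ / a)) t) *
        (polyaWeight a α₂ p.2 * charFun (erlangMeasure p.2 (β₂ / a)) (-t)) := by
    ext p
    have hw := mul_nonneg (polyaWeight_nonneg ha.le ha1 hα₁ p.1)
      (polyaWeight_nonneg ha.le ha1 hα₂ p.2)
    rw [integral_smul_measure, ← charFun_apply_real, charFun_conv, charFun_map_neg,
      ENNReal.toReal_ofReal hw, Complex.real_smul, Complex.ofReal_mul]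
    ring
  rw [e] at hs
  exact hs.unique hp

/-- The four groups, according to which indices vanish, correspond to the atom, the two one-sided
series and the double series of `g_a`. -/
theorem ENNReal.tsum_nat_prod_eq (f : ℕ × ℕ → ℝ≥0∞) :
    ∑' p, f p = f (0, 0) + ∑' n, f (n + 1, 0) + ∑' m, f (0, m + 1) +
      ∑' p : ℕ × ℕ, f (p.1 + 1, p.2 + 1) := by
  rw [ENNReal.tsum_prod', tsum_eq_zero_add' ENNReal.summable,
    tsum_eq_zero_add' (f := fun m => f (0, m)) ENNReal.summable]
  have h : ∀ n, ∑' m, f (n + 1, m) = f (n + 1, 0) + ∑' m, f (n + 1, m + 1) := fun n =>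
    tsum_eq_zero_add' ENNReal.summable
  simp_rw [h]
  rw [ENNReal.tsum_add, ENNReal.tsum_prod']
  ring

theorem remainderMeasureAt_zero (ha : 0 < a) (ha1 : a ≤ 1) (hα₁ : 0 < α₁)
    (hβ₁ : 0 < β₁) (hα₂ : 0 < α₂) (hβ₂ : 0 < β₂) :
    remainderMeasureAt a α₁ β₁ α₂ β₂ 0 = polyaErlangMeasure a α₁ β₁ α₂ β₂ := by
  have h1 := fun n => isProbabilityMeasure_erlangMeasure n (div_pos hβ₁ ha)
  have h2 := fun n => isProbabilityMeasure_erlangMeasure n (div_pos hβ₂ ha)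
  have h3 := fun n => Measure.isProbabilityMeasure_map (μ := erlangMeasure n (β₂ / a))
    (f := fun x => -x) (by fun_prop)
  have hm : ∀ a r : ℝ, Measurable (gammaPDF a r) := fun a r =>
    (measurable_gammaPDFReal a r).ennreal_ofReal
  have hw₁ := polyaWeight_nonneg ha.le ha1 hα₁
  have hw₂ := polyaWeight_nonneg ha.le ha1 hα₂
  have hup : ∀ n, (fun x => ENNReal.ofReal (upTerm a α₁ β₁ α₂ x n)) =
      ENNReal.ofReal (polyaWeight a α₁ (n + 1) * polyaWeight a α₂ 0) •
        gammaPDF ((n + 1 : ℕ) : ℝ) (β₁ / a) := by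
    intro n
    ext x
    rw [upTerm, ENNReal.ofReal_mul (by have := hw₁ (n + 1); positivity), polyaWeight_zero]
    rfl
  have hdown : ∀ n, (fun x => ENNReal.ofReal (downTerm a α₁ α₂ β₂ x n)) =
      ENNReal.ofReal (polyaWeight a α₁ 0 * polyaWeight a α₂ (n + 1)) •
        fun x => gammaPDF ((n + 1 : ℕ) : ℝ) (β₂ / a) (-x) := by
    intro n
    ext x
    rw [downTerm, ENNReal.ofReal_mul (by have := hw₂ (n + 1); positivity), polyaWeight_zero]
    rfl
  have hboth : ∀ p : ℕ × ℕ, (fun x => ENNReal.ofReal (bothTerm a α₁ β₁ α₂ β₂ x p)) =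
      ENNReal.ofReal (polyaWeight a α₁ (p.1 + 1) * polyaWeight a α₂ (p.2 + 1)) •
        fun x => ENNReal.ofReal (erlangDiffPDF (p.1 + 1) (p.2 + 1) (β₁ / a) (β₂ / a) x) := by
    intro p
    ext x
    rw [bothTerm, ENNReal.ofReal_mul (mul_nonneg (hw₁ _) (hw₂ _))]
    rfl
  have hmg : ∀ n r, Measurable fun x => gammaPDF n r (-x) := fun n r =>
    (hm n r).comp measurable_neg
  have hme : ∀ n m b c, Measurable fun x => ENNReal.ofReal (erlangDiffPDF n m b c x) :=
    fun n m b c => (measurable_erlangDiffPDF n m b c).ennreal_ofReal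
  -- Nonnegativity and pointwise summability allow `ENNReal.ofReal` to pass through the real series;
  -- from here on sums of measures need no convergence argument.
  have hd : (fun x : ℝ => ENNReal.ofReal (remainderDensity a α₁ β₁ α₂ β₂ (x - 0))) =
      (∑' n, fun x => ENNReal.ofReal (upTerm a α₁ β₁ α₂ x n)) +
      (∑' n, fun x => ENNReal.ofReal (downTerm a α₁ α₂ β₂ x n)) +
      (∑' p, fun x => ENNReal.ofReal (bothTerm a α₁ β₁ α₂ β₂ x p)) := by
    ext x
    have n1 := upTerm_nonneg (α₂ := α₂) ha ha1 hα₁ hβ₁ x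
    have n2 := upTerm_nonneg (α₂ := α₁) ha ha1 hα₂ hβ₂ (-x)
    have n3 := bothTerm_nonneg ha ha1 hα₁ hβ₁ hα₂ hβ₂ x
    rw [remainderDensity, sub_zero]
    simp only [Pi.add_apply, downTerm_eq_upTerm]
    rw [ENNReal.ofReal_add (add_nonneg (tsum_nonneg n1) (tsum_nonneg n2)) (tsum_nonneg n3),
      ENNReal.ofReal_add (tsum_nonneg n1) (tsum_nonneg n2),
      ENNReal.ofReal_tsum_of_nonneg n1 (summable_upTerm ha ha1 hα₁ hβ₁ x),
      ENNReal.ofReal_tsum_of_nonneg n2 (summable_upTerm ha ha1 hα₂ hβ₂ (-x)),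
      ENNReal.ofReal_tsum_of_nonneg n3 (summable_bothTerm ha ha1 hα₁ hβ₁ hα₂ hβ₂ x),
      tsum_apply (Pi.summable.2 fun _ => ENNReal.summable),
      tsum_apply (Pi.summable.2 fun _ => ENNReal.summable),
      tsum_apply (Pi.summable.2 fun _ => ENNReal.summable)]
  rw [tsum_congr hup, tsum_congr hdown, tsum_congr hboth] at hd
  rw [remainderMeasureAt, hd]
  rw [withDensity_add_right _ (Measurable.tsum' fun p => (hme _ _ _ _).const_smul _),
    withDensity_add_right _ (Measurable.tsum' fun p => (hmg _ _).const_smul _),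
    withDensity_tsum fun n => (hm _ _).const_smul _,
    withDensity_tsum fun n => (hmg _ _).const_smul _,
    withDensity_tsum fun n => (hme _ _ _ _).const_smul _]
  simp_rw [withDensity_smul _ (hm _ _), withDensity_smul _ (hmg _ _),
    withDensity_smul _ (hme _ _ _ _), ← map_neg_withDensity,
    ← gammaMeasure_conv_map_neg_gammaMeasure _ _ (div_pos hβ₁ ha) (div_pos hβ₂ ha)]
  ext s hs
  rw [polyaErlangMeasure, Measure.sum_apply _ hs, ENNReal.tsum_nat_prod_eq]
  simp only [Measure.add_apply, Measure.sum_apply _ hs, Measure.smul_apply, add_assoc]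
  -- Shape `0` is the unit mass at the origin, neutral for convolution: terms with one zero shape
  -- become one-sided, and the term with both zero is the atom.
  have e0 : ∀ r, erlangMeasure 0 r = Measure.dirac 0 := fun r => if_pos rfl
  have es : ∀ n r, erlangMeasure (n + 1) r = gammaMeasure ((n + 1 : ℕ) : ℝ) r :=
    fun n r => if_neg (Nat.succ_ne_zero n)
  have en : (Measure.dirac (0 : ℝ)).map (fun x => -x) = Measure.dirac 0 := by
    rw [Measure.map_dirac' measurable_neg, neg_zero]
  have hg : ∀ n : ℕ, SFinite (gammaMeasure ((n + 1 : ℕ) : ℝ) (β₁ / a)) := fun n => by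
    rw [← es]; infer_instance
  have hg' : ∀ n : ℕ, SFinite ((gammaMeasure ((n + 1 : ℕ) : ℝ) (β₂ / a)).map (fun x => -x)) :=
    fun n => by rw [← es]; infer_instance
  simp only [e0, es, en, Measure.conv_dirac_zero, Measure.dirac_zero_conv, polyaWeight_zero,
    ← Real.rpow_add ha]
  rfl

end

theorem map_add_right_remainderMeasureAt (a α₁ β₁ α₂ β₂ c : ℝ) :
    (remainderMeasureAt a α₁ β₁ α₂ β₂ 0).map (fun x => x + c) =
      remainderMeasureAt a α₁ β₁ α₂ β₂ c := by
  have hm : Measurable fun x : ℝ => x + c := by fun_prop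
  rw [remainderMeasureAt, remainderMeasureAt, Measure.map_add _ _ hm, Measure.map_smul,
    Measure.map_dirac' hm, zero_add]
  congr 1
  ext s hs
  rw [Measure.map_apply hm hs, withDensity_apply _ hs, withDensity_apply _ (hm hs),
    ← lintegral_indicator hs, ← lintegral_indicator (hm hs),
    ← lintegral_add_right_eq_self (fun x => s.indicator _ x) c]
  refine lintegral_congr fun x => ?_
  have hx : x ∈ (fun x => x + c) ⁻¹' s ↔ x + c ∈ s := Iff.rfl
  by_cases h : x + c ∈ s
  · rw [indicator_of_mem (hx.2 h), indicator_of_mem h, sub_zero, add_sub_cancel_right]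
  · rw [indicator_of_notMem (mt hx.1 h), indicator_of_notMem h]

end

/-! ### Independence for Poisson processes and random sums -/

section

variable {Ω : Type*} [mΩ : MeasurableSpace Ω] {P : Measure Ω}

/-- Puts finitely many times up to `s`, followed by `u`, in the form required for independence of
increments along a monotone sequence: `N u - N s` is increment number `c`, and the values at the
given times are sums of earlier increments. -/
theorem exists_monotone_seq_of_finset (J : Finset ℝ≥0) (h0 : 0 ∈ J) {s u : ℝ≥0} (hs : s ∈ J)
    (hJ : ∀ v ∈ J, v ≤ s) (hsu : s ≤ u) :
    ∃ (t : ℕ → ℝ≥0) (c : ℕ), Monotone t ∧ t 0 = 0 ∧ t c = s ∧ t (c + 1) = u ∧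
      ∀ v ∈ J, ∃ i ≤ c, t i = v := by
  have hne : J.Nonempty := ⟨0, h0⟩
  obtain ⟨c, hc⟩ : ∃ c, J.card = c + 1 := ⟨J.card - 1, by have := hne.card_pos; omega⟩
  let e := J.orderEmbOfFin hc
  have heJ : ∀ i, e i ∈ J := fun i => J.orderEmbOfFin_mem hc i
  have hsurj : ∀ v ∈ J, ∃ i, e i = v := by
    intro v hv
    have : v ∈ Set.range e := by rw [J.range_orderEmbOfFin hc]; exact hv
    exact this
  refine ⟨fun i => if hi : i < c + 1 then e ⟨i, hi⟩ else u, c, ?_, ?_, ?_, ?_, ?_⟩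
  · intro i j hij
    dsimp only
    split_ifs with h1 h2
    · exact e.monotone hij
    · exact (hJ _ (heJ _)).trans hsu
    · omega
    · exact le_rfl
  · obtain ⟨i, hi⟩ := hsurj 0 h0
    refine (dif_pos (Nat.succ_pos c)).trans ?_
    exact le_antisymm ((e.monotone (Fin.zero_le i)).trans_eq hi) zero_le
  · obtain ⟨i, hi⟩ := hsurj s hs
    refine (dif_pos (Nat.lt_succ_self c)).trans ?_
    exact le_antisymm (hJ _ (heJ _)) (hi.symm.trans_le (e.monotone (Fin.le_last i)))
  · simp
  · intro v hv
    obtain ⟨i, hi⟩ := hsurj v hv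
    exact ⟨i, Nat.lt_succ_iff.1 i.2, (dif_pos i.2).trans hi⟩

omit mΩ in
theorem measurable_sum_range {β : Type*} [MeasurableSpace β] [AddCommMonoid β] [MeasurableAdd₂ β]
    {m : MeasurableSpace Ω} {f : ℕ → Ω → β} {n : ℕ} (hf : ∀ i < n, Measurable (f i)) :
    Measurable fun ω => ∑ i ∈ Finset.range n, f i ω :=
  Finset.measurable_fun_sum _ fun i hi => hf i (Finset.mem_range.1 hi)

theorem IsPoissonProcess.indepFun_past [IsProbabilityMeasure P] {r : ℝ} {N : ℝ≥0 → Ω → ℕ}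
    (hN : IsPoissonProcess P r N) (s h : ℝ≥0) :
    IndepFun (fun ω (v : Iic s) => N v ω) (fun ω => N (s + h) ω - N s ω) P := by
  have hΔ : ∀ u v : ℝ≥0, Measurable fun ω => N u ω - N v ω := fun u v =>
    (hN.measurable u).sub (hN.measurable v)
  refine IndepFun.process_indepFun (fun v => hN.measurable v) (hΔ _ _) fun I => ?_
  -- Finitely many past times suffice. Adding `0` and `s` makes the telescoping sums start at `N 0 =
  -- 0` and the last increment start exactly at `s`.
  obtain ⟨t, c, ht, ht0, htc, htc1, hidx⟩ := exists_monotone_seq_of_finset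
    (insert 0 (insert s (I.map (Function.Embedding.subtype _)))) (by simp) (s := s) (by simp)
    (u := s + h) (by
      intro v hv
      simp only [Finset.mem_insert, Finset.mem_map, Function.Embedding.subtype_apply] at hv
      rcases hv with rfl | rfl | ⟨w, _, rfl⟩
      · exact zero_le
      · exact le_rfl
      · exact w.2) le_self_add
  have hidx' : ∀ v : I, ∃ i ≤ c, t i = v := fun v => hidx _ (Finset.mem_insert_of_mem
    (Finset.mem_insert_of_mem (Finset.mem_map_of_mem _ v.2)))
  choose idx hidxc hidxt using hidx'
  have hind := hN.indep.nat ht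
  rw [iIndepFun_iff_iIndep] at hind
  have hind2 := indep_iSup_of_disjoint (fun i => (hΔ (t (i + 1)) (t i)).comap_le) hind
    (S := Iio c) (T := {c}) (by simp)
  have key : IndepFun (fun ω (v : I) => ∑ j ∈ Finset.range (idx v), (N (t (j + 1)) ω - N (t j) ω))
      (fun ω => N (s + h) ω - N s ω) P := by
    rw [IndepFun_iff_Indep]
    refine indep_of_indep_of_le_left (indep_of_indep_of_le_right hind2 ?_) ?_
    · simp [htc, htc1]
    · refine Measurable.comap_le (@measurable_pi_lambda _ _ _ (_) _ _ ?_)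
      refine fun v => measurable_sum_range fun j hj => ?_
      rw [measurable_iff_comap_le]
      exact le_iSup₂_of_le (f := fun i (_ : i ∈ Iio c) => MeasurableSpace.comap
        (fun ω => N (t (i + 1)) ω - N (t i) ω) _) j
        (hj.trans_le (hidxc v)) le_rfl
  refine key.congr ?_ .rfl
  -- Telescoping with truncated subtraction in `ℕ` needs monotone paths, so the identity holds only
  -- almost surely.
  filter_upwards [hN.zero, hN.paths] with ω h0 hω
  ext v
  rw [Finset.sum_range_tsub (f := fun j => N (t j) ω) (fun i j hij => hω.1 (ht hij)),
    ht0, h0, hidxt v, Nat.sub_zero]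

/-- The hypotheses make the four σ-algebras mutually independent, so they can be regrouped. It is
checked on intersections `A ∩ B`, a π-system generating each supremum. Here `a` plays the past and
`b` the future of each of two sources. -/
theorem indep_sup_sup {Ω : Type*} {mΩ : MeasurableSpace Ω} {P : Measure Ω}
    [IsProbabilityMeasure P] {a₁ a₂ b₁ b₂ : MeasurableSpace Ω}
    (ha₁ : a₁ ≤ mΩ) (ha₂ : a₂ ≤ mΩ) (hb₁ : b₁ ≤ mΩ) (hb₂ : b₂ ≤ mΩ)
    (h : Indep (a₁ ⊔ b₁) (a₂ ⊔ b₂) P) (h₁ : Indep a₁ b₁ P) (h₂ : Indep a₂ b₂ P) :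
    Indep (a₁ ⊔ a₂) (b₁ ⊔ b₂) P := by
  let π (a b : MeasurableSpace Ω) : Set (Set Ω) :=
    {t | ∃ A B, MeasurableSet[a] A ∧ MeasurableSet[b] B ∧ t = A ∩ B}
  have hπ : ∀ a b, IsPiSystem (π a b) := by
    rintro a b _ ⟨A, B, hA, hB, rfl⟩ _ ⟨A', B', hA', hB', rfl⟩ _
    exact ⟨A ∩ A', B ∩ B', hA.inter hA', hB.inter hB', inter_inter_inter_comm _ _ _ _⟩
  have hgen : ∀ a b, a ⊔ b = MeasurableSpace.generateFrom (π a b) := by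
    intro a b
    refine le_antisymm (sup_le ?_ ?_) (MeasurableSpace.generateFrom_le ?_)
    · exact fun A hA => MeasurableSpace.measurableSet_generateFrom
        ⟨A, univ, hA, MeasurableSet.univ, (inter_univ _).symm⟩
    · exact fun B hB => MeasurableSpace.measurableSet_generateFrom
        ⟨univ, B, MeasurableSet.univ, hB, (univ_inter _).symm⟩
    · rintro _ ⟨A, B, hA, hB, rfl⟩
      exact (le_sup_left (b := b) _ hA).inter (le_sup_right (a := a) _ hB)
  refine IndepSets.indep (sup_le ha₁ ha₂) (sup_le hb₁ hb₂) (hπ _ _) (hπ _ _) (hgen _ _)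
    (hgen _ _) ?_
  rw [IndepSets_iff]
  rintro _ _ ⟨A₁, A₂, hA₁, hA₂, rfl⟩ ⟨B₁, B₂, hB₁, hB₂, rfl⟩
  rw [Indep_iff] at h h₁ h₂
  have l₁ := le_sup_left (a := a₁) (b := b₁)
  have l₂ := le_sup_right (a := a₁) (b := b₁)
  have l₃ := le_sup_left (a := a₂) (b := b₂)
  have l₄ := le_sup_right (a := a₂) (b := b₂)
  rw [inter_inter_inter_comm, h _ _ ((l₁ _ hA₁).inter (l₂ _ hB₁)) ((l₃ _ hA₂).inter (l₄ _ hB₂)),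
    h₁ _ _ hA₁ hB₁, h₂ _ _ hA₂ hB₂, h _ _ (l₁ _ hA₁) (l₃ _ hA₂), h _ _ (l₂ _ hB₁) (l₄ _ hB₂)]
  ring

/-- The sum of a random number `M` of terms of the sequence `V`. -/
noncomputable def randomSum (M : Ω → ℕ) (V : ℕ → Ω → ℝ) (ω : Ω) : ℝ :=
  ∑ n ∈ Finset.range (M ω), V n ω

omit mΩ in
theorem measurable_randomSum {m : MeasurableSpace Ω} {M : Ω → ℕ} {V : ℕ → Ω → ℝ}
    (hM : Measurable M) (hV : ∀ n, Measurable (V n)) : Measurable (randomSum M V) := by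
  have h : Measurable fun p : Ω × ℕ => ∑ n ∈ Finset.range p.2, V n p.1 :=
    measurable_from_prod_countable_left fun n => by
      simpa only using Finset.measurable_fun_sum (Finset.range n) fun i _ => hV i
  exact h.comp (measurable_id.prodMk hM)

/-- The characteristic function of a sum of a Poisson number of mean `r` of exponential variables
of rate `β`. -/
noncomputable def compoundPoissonExpCharFun (r β ξ : ℝ) : ℂ :=
  Complex.exp (r * ((β : ℂ) / (β - ξ * Complex.I) - 1))

theorem charFun_expMeasure {β : ℝ} (hβ : 0 < β) (ξ : ℝ) :
    charFun (expMeasure β) ξ = (β : ℂ) / (β - ξ * Complex.I) := by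
  have h := charFun_gammaMeasure_natCast_succ 0 hβ ξ
  simpa [expMeasure] using h

/-- On `M = p` the sum has `p` independent exponential terms and contributes `z ^ p`; the Poisson
weights turn these powers into an exponential series. -/
theorem integral_cexp_randomSum [IsProbabilityMeasure P] {r : ℝ≥0} {β : ℝ} (hβ : 0 < β) {M : Ω → ℕ}
    {V : ℕ → Ω → ℝ} (hM : Measurable M) (hV : ∀ n, Measurable (V n))
    (hMl : HasLaw M (poissonMeasure r) P) (hVl : ∀ n, HasLaw (V n) (expMeasure β) P)
    (hVi : iIndepFun V P)
    (hMV : Indep (MeasurableSpace.comap M inferInstance)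
      (⨆ n, MeasurableSpace.comap (V n) inferInstance) P) (ξ : ℝ) :
    ∫ ω, Complex.exp (ξ * randomSum M V ω * Complex.I) ∂P = compoundPoissonExpCharFun r β ξ := by
  set z : ℂ := (β : ℂ) / (β - ξ * Complex.I) with hz
  have hS : ∀ p : ℕ, Measurable fun ω => ∑ n ∈ Finset.range p, V n ω := fun p =>
    Finset.measurable_fun_sum _ fun i _ => hV i
  have hpart : ∀ p : ℕ, ∫ ω, Complex.exp (ξ * (∑ n ∈ Finset.range p, V n ω : ℝ) * Complex.I) ∂P
      = z ^ p := by
    intro p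
    have h := iIndepFun.charFun_map_fun_finsetSum_eq_prod (s := Finset.range p)
      (P := P) (X := V) (fun i _ => (hV i).aemeasurable) (hVi.restrict _)
    have h2 := congrFun h ξ
    rw [charFun_apply_real, integral_map (hS p).aemeasurable (by fun_prop)] at h2
    rw [h2]
    simp only [Finset.prod_apply, (hVl _).map_eq, charFun_expMeasure hβ, Finset.prod_const,
      Finset.card_range, hz]
  have hint : Integrable (fun ω => Complex.exp (ξ * randomSum M V ω * Complex.I)) P := by
    simpa using integrable_cexp_ofReal_mul_I (μ := P) (f := fun ω => ξ * randomSum M V ω)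
      ((measurable_randomSum hM hV).const_mul ξ)
  have hU : ⋃ p, M ⁻¹' {p} = univ := by ext; simp
  have hsum := hasSum_integral_iUnion (μ := P) (s := fun p => M ⁻¹' {p})
    (fun p => hM (measurableSet_singleton p))
    (fun p q hpq => Disjoint.preimage _ (by simpa using hpq)) (by rw [hU]; exact hint.integrableOn)
  rw [hU, setIntegral_univ] at hsum
  have hterm : ∀ p : ℕ, ∫ ω in M ⁻¹' {p}, Complex.exp (ξ * randomSum M V ω * Complex.I) ∂P =
      Real.exp (-r) * ((r * z) ^ p / p !) := by
    intro p
    have hset : MeasurableSet (M ⁻¹' {p}) := hM (measurableSet_singleton p)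
    have e1 : ∫ ω in M ⁻¹' {p}, Complex.exp (ξ * randomSum M V ω * Complex.I) ∂P =
        ∫ ω, (M ⁻¹' {p}).indicator (fun _ => (1 : ℂ)) ω *
          Complex.exp (ξ * (∑ n ∈ Finset.range p, V n ω : ℝ) * Complex.I) ∂P := by
      rw [← integral_indicator hset]
      refine integral_congr_ae (ae_of_all _ fun ω => ?_)
      by_cases hω : ω ∈ M ⁻¹' {p}
      · have hω' : M ω = p := hω
        simp only [indicator_of_mem hω, one_mul, randomSum, hω']
      · simp only [indicator_of_notMem hω, zero_mul]
    have hm : Measurable[⨆ n, MeasurableSpace.comap (V n) inferInstance] fun ω =>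
        Complex.exp (ξ * (∑ n ∈ Finset.range p, V n ω : ℝ) * Complex.I) := by
      have h1 : Measurable[⨆ n, MeasurableSpace.comap (V n) inferInstance] fun ω =>
          ∑ n ∈ Finset.range p, V n ω := by
        refine measurable_sum_range fun i _ => ?_
        exact (comap_measurable (V i)).mono (le_iSup (fun n => MeasurableSpace.comap (V n) _) i)
          le_rfl
      fun_prop
    have hi : IndepFun ((M ⁻¹' {p}).indicator (fun _ => (1 : ℂ)))
        (fun ω => Complex.exp (ξ * (∑ n ∈ Finset.range p, V n ω : ℝ) * Complex.I)) P := by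
      rw [IndepFun_iff_Indep]
      refine indep_of_indep_of_le_left (indep_of_indep_of_le_right hMV hm.comap_le) ?_
      refine Measurable.comap_le (measurable_const.indicator ?_)
      exact ⟨{p}, measurableSet_singleton p, rfl⟩
    have hprob : P.real (M ⁻¹' {p}) = Real.exp (-r) * r ^ p / p ! := by
      rw [← poissonMeasure_real_singleton, ← hMl.map_eq, map_measureReal_apply hM
        (measurableSet_singleton p)]
    rw [e1, hi.integral_fun_mul_eq_mul_integral
      (measurable_const.indicator hset).aestronglyMeasurable
      (by have := hS p; exact Measurable.aestronglyMeasurable (by fun_prop)), hpart,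
      integral_indicator_const _ hset, hprob]
    rw [Complex.real_smul]
    push_cast
    rw [mul_pow]
    ring
  simp_rw [hterm] at hsum
  have hexp := (NormedSpace.expSeries_div_hasSum_exp (𝔸 := ℂ) (r * z)).mul_left (Real.exp (-r) : ℂ)
  rw [hsum.unique hexp, compoundPoissonExpCharFun, ← Complex.exp_eq_exp_ℂ, Complex.ofReal_exp,
    ← Complex.exp_add]
  push_cast
  congr 1
  ring

end

/-! ### Increments of a compound Poisson process are independent of its past -/

section

variable {Ω : Type*} {E : MeasurableSpace Ω} [mΩ : MeasurableSpace Ω] {P : Measure Ω}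

theorem measure_eq_tsum_inter_fiber {M : Ω → ℕ} (hM : Measurable M) {S : Set Ω}
    (hS : MeasurableSet S) : P S = ∑' n, P (S ∩ M ⁻¹' {n}) := by
  rw [← measure_iUnion _ fun n => hS.inter (hM (measurableSet_singleton n)), ← inter_iUnion]
  · congr 1
    ext ω
    simp
  · exact fun m n hmn => (Disjoint.preimage M (by simpa using hmn)).mono inter_subset_right
      inter_subset_right

section OneSided

variable [IsProbabilityMeasure P] {r β : ℝ} {N : ℝ≥0 → Ω → ℕ} {U : ℕ → Ω → ℝ}

/-- The value does not involve `n`, the number of jumps already used; this is what removes the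
conditioning on `N s`. -/
theorem integral_cexp_shifted (hβ : 0 < β) (hN : IsPoissonProcess P r N)
    (hU : ∀ n, Measurable (U n)) (hUl : ∀ n, HasLaw (U n) (expMeasure β) P) (hUi : iIndepFun U P)
    (hNU : Indep (⨆ t, MeasurableSpace.comap (N t) inferInstance)
      (⨆ n, MeasurableSpace.comap (U n) inferInstance) P) (s h : ℝ≥0) (n : ℕ) (ξ : ℝ) :
    ∫ ω, Complex.exp (ξ * randomSum (fun ω => N (s + h) ω - N s ω) (fun j => U (n + j)) ω *
      Complex.I) ∂P = compoundPoissonExpCharFun (r.toNNReal * h : ℝ≥0) β ξ := by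
  refine integral_cexp_randomSum hβ ((hN.measurable _).sub (hN.measurable _)) (fun j => hU _)
    (hN.law s h) (fun j => hUl _) (hUi.precomp (add_right_injective n)) ?_ ξ
  refine indep_of_indep_of_le_left (indep_of_indep_of_le_right hNU ?_) ?_
  · exact iSup_le fun j => le_iSup (fun n => MeasurableSpace.comap (U n) _) (n + j)
  · have h1 : ∀ t, Measurable[⨆ t, MeasurableSpace.comap (N t) inferInstance] (N t) := fun t =>
      (comap_measurable (N t)).mono (le_iSup (fun t => MeasurableSpace.comap (N t) _) t) le_rfl
    exact Measurable.comap_le (@Measurable.sub _ _ _ _ _ (_) _ _ (h1 (s + h)) (h1 s))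

/-- Here `E` carries outside information: the initial value and the opposite side of the driver. The
past and future of the counting process are first joined with the early and late jumps, and `E` is
then adjoined to the past. -/
theorem indep_past_future (hN : IsPoissonProcess P r N)
    (hU : ∀ n, Measurable (U n)) (hUi : iIndepFun U P)
    (hNU : Indep (⨆ t, MeasurableSpace.comap (N t) inferInstance)
      (⨆ n, MeasurableSpace.comap (U n) inferInstance) P) (hE : E ≤ mΩ)
    (hENU : Indep E ((⨆ t, MeasurableSpace.comap (N t) inferInstance) ⊔
      (⨆ n, MeasurableSpace.comap (U n) inferInstance)) P) (s h : ℝ≥0) (n : ℕ) :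
    Indep (E ⊔ ((⨆ v : Iic s, MeasurableSpace.comap (N v) inferInstance) ⊔
        ⨆ i ∈ Iio n, MeasurableSpace.comap (U i) inferInstance))
      (MeasurableSpace.comap (fun ω => N (s + h) ω - N s ω) inferInstance ⊔
        ⨆ i ∈ Ici n, MeasurableSpace.comap (U i) inferInstance) P := by
  have hNc : ∀ t, MeasurableSpace.comap (N t) inferInstance ≤ mΩ :=
    fun t => (hN.measurable t).comap_le
  have hUc : ∀ t, MeasurableSpace.comap (U t) inferInstance ≤ mΩ := fun t => (hU t).comap_le
  have hind := fun s h => hN.indepFun_past s h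
  set σN := ⨆ t, MeasurableSpace.comap (N t) inferInstance with hσN
  set σU := ⨆ n, MeasurableSpace.comap (U n) inferInstance with hσU
  have hσN' : σN ≤ mΩ := iSup_le hNc
  have hσU' : σU ≤ mΩ := iSup_le hUc
  have la₁ : ⨆ v : Iic s, MeasurableSpace.comap (N v) inferInstance ≤ σN :=
    iSup_le fun v => le_iSup (fun t => MeasurableSpace.comap (N t) _) (v : ℝ≥0)
  have lb₁ : MeasurableSpace.comap (fun ω => N (s + h) ω - N s ω) inferInstance ≤ σN := by
    have h1 : ∀ t, Measurable[σN] (N t) := fun t =>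
      (comap_measurable (N t)).mono (le_iSup (fun t => MeasurableSpace.comap (N t) _) t) le_rfl
    exact Measurable.comap_le (@Measurable.sub _ _ _ _ _ (_) _ _ (h1 (s + h)) (h1 s))
  have la₂ : ⨆ i ∈ Iio n, MeasurableSpace.comap (U i) inferInstance ≤ σU :=
    iSup₂_le fun i _ => le_iSup (fun t => MeasurableSpace.comap (U t) _) i
  have lb₂ : ⨆ i ∈ Ici n, MeasurableSpace.comap (U i) inferInstance ≤ σU :=
    iSup₂_le fun i _ => le_iSup (fun t => MeasurableSpace.comap (U t) _) i
  have i₁ : Indep (⨆ v : Iic s, MeasurableSpace.comap (N v) inferInstance)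
      (MeasurableSpace.comap (fun ω => N (s + h) ω - N s ω) inferInstance) P := by
    refine indep_of_indep_of_le_left ((IndepFun_iff_Indep _ _ _).1 (hind s h))
      (iSup_le fun v => ?_)
    rw [show N v = (fun x : Iic s → ℕ => x v) ∘ fun ω (v : Iic s) => N v ω from rfl,
      ← MeasurableSpace.comap_comp]
    exact MeasurableSpace.comap_mono (measurable_pi_apply v).comap_le
  have i₂ : Indep (⨆ i ∈ Iio n, MeasurableSpace.comap (U i) inferInstance)
      (⨆ i ∈ Ici n, MeasurableSpace.comap (U i) inferInstance) P :=
    indep_iSup_of_disjoint hUc hUi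
      (disjoint_left.2 fun i (hi : i < n) (hi' : n ≤ i) => not_lt.2 hi' hi)
  have h₁ := indep_sup_sup (la₁.trans hσN') (la₂.trans hσU') (lb₁.trans hσN') (lb₂.trans hσU')
    (indep_of_indep_of_le_left (indep_of_indep_of_le_right hNU (sup_le la₂ lb₂)) (sup_le la₁ lb₁))
    i₁ i₂
  have la := sup_le_sup la₁ la₂
  have lb := sup_le_sup lb₁ lb₂
  -- `E` has no future part, whence the trivial σ-algebra `⊥`.
  have h₂ := indep_sup_sup (b₁ := ⊥) hE (la.trans (sup_le hσN' hσU')) bot_le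
    (lb.trans (sup_le hσN' hσU')) (by
      rw [sup_bot_eq]
      exact indep_of_indep_of_le_right hENU (sup_le la lb)) (indep_bot_right E) h₁
  rwa [bot_sup_eq] at h₂

omit mΩ in
theorem measurable_ite_lt {m : MeasurableSpace Ω} {M : Ω → ℕ} {f : Ω → ℝ} {i : ℕ}
    (hM : Measurable M) (hf : Measurable f) : Measurable fun ω => if i < M ω then f ω else 0 :=
  Measurable.ite (hM measurableSet_Ioi) hf measurable_const

omit [IsProbabilityMeasure P] in
-- On `N s = n` one has `N v ≤ n` for `v ≤ s`, so the random sum at `v` is the sum over `i < n` of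
-- `U i` cut off by `i < N v`: only the first `n` jumps occur. Sets that agree almost everywhere on
-- this fiber with a set of `H` form a σ-algebra, so it is enough to treat the generators.
theorem exists_measurableSet_past (hN : IsPoissonProcess P r N) (s : ℝ≥0) (n : ℕ) {A : Set Ω}
    (hA : MeasurableSet[E ⊔ ⨆ v : Iic s, MeasurableSpace.comap (randomSum (N v) U) inferInstance]
      A) :
    ∃ A', MeasurableSet[E ⊔ ((⨆ v : Iic s, MeasurableSpace.comap (N v) inferInstance) ⊔
        ⨆ i ∈ Iio n, MeasurableSpace.comap (U i) inferInstance)] A' ∧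
      ∀ᵐ ω ∂P, N s ω = n → (ω ∈ A ↔ ω ∈ A') := by
  have hfib : MeasurableSet {ω | N s ω = n} := hN.measurable s (measurableSet_singleton n)
  have hpaths := hN.paths
  let Q := P.restrict {ω | N s ω = n}
  have hafib := fun p => (ae_restrict_iff' (μ := P) (p := p) hfib).1
  have hafib' := fun p => (ae_restrict_iff' (μ := P) (p := p) hfib).2
  set H := E ⊔ ((⨆ v : Iic s, MeasurableSpace.comap (N v) inferInstance) ⊔
        ⨆ i ∈ Iio n, MeasurableSpace.comap (U i) inferInstance) with hH
  have hle : E ⊔ ⨆ v : Iic s, MeasurableSpace.comap (randomSum (N v) U) inferInstance ≤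
      eventuallyMeasurableSpace H (ae Q) := by
    refine sup_le ((le_sup_left).trans (le_eventuallyMeasurableSpace (m := H))) (iSup_le fun v => ?_)
    have hNv : Measurable[H] (N v) := (comap_measurable (N v)).mono
      ((le_iSup (fun v : Iic s => MeasurableSpace.comap (N v) _) v).trans
        (le_sup_left.trans le_sup_right)) le_rfl
    have hUi : ∀ i < n, Measurable[H] (U i) := fun i hi => (comap_measurable (U i)).mono
      ((le_iSup₂ (f := fun i (_ : i ∈ Iio n) => MeasurableSpace.comap (U i) _) i hi).trans
        (le_sup_right.trans le_sup_right)) le_rfl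
    have hm : Measurable[H] fun ω => ∑ i ∈ Finset.range n, if i < N v ω then U i ω else 0 :=
      measurable_sum_range fun i hi => measurable_ite_lt hNv (hUi i hi)
    refine Measurable.comap_le (EventuallyMeasurable.congr
      (Measurable.eventuallyMeasurable (l := ae Q) hm) ?_)
    refine hafib' _ ?_
    filter_upwards [hpaths] with ω hω hn
    have hle : N v ω ≤ n := hn ▸ hω.1 v.2
    rw [randomSum, ← Finset.sum_filter]
    congr 1
    ext i
    simp only [Finset.mem_range, Finset.mem_filter]
    omega
  obtain ⟨A', hA', hAA'⟩ := hle A hA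
  refine ⟨A', hA', ?_⟩
  exact hafib _ (Filter.eventuallyEq_set.1 hAA')

theorem indep_compound_increment (hβ : 0 < β) (hN : IsPoissonProcess P r N)
    (hU : ∀ n, Measurable (U n)) (hUl : ∀ n, HasLaw (U n) (expMeasure β) P) (hUi : iIndepFun U P)
    (hNU : Indep (⨆ t, MeasurableSpace.comap (N t) inferInstance)
      (⨆ n, MeasurableSpace.comap (U n) inferInstance) P) (hE : E ≤ mΩ)
    (hENU : Indep E ((⨆ t, MeasurableSpace.comap (N t) inferInstance) ⊔
      (⨆ n, MeasurableSpace.comap (U n) inferInstance)) P) (s h : ℝ≥0) :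
    Indep (E ⊔ ⨆ v : Iic s, MeasurableSpace.comap (randomSum (N v) U) inferInstance)
      (MeasurableSpace.comap (fun ω => randomSum (N (s + h)) U ω - randomSum (N s) U ω)
        inferInstance) P ∧
    ∀ ξ : ℝ, ∫ ω, Complex.exp (ξ * ((randomSum (N (s + h)) U ω - randomSum (N s) U ω : ℝ) : ℂ) *
      Complex.I) ∂P = compoundPoissonExpCharFun (r.toNNReal * h : ℝ≥0) β ξ := by
  set D : Ω → ℕ := fun ω => N (s + h) ω - N s ω with hD
  set W : ℕ → Ω → ℝ := fun n => randomSum D (fun j => U (n + j)) with hW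
  set ΔM : Ω → ℝ := fun ω => randomSum (N (s + h)) U ω - randomSum (N s) U ω with hΔM
  have hDm : Measurable D := (hN.measurable _).sub (hN.measurable _)
  have hWm : ∀ n, Measurable (W n) := fun n => measurable_randomSum hDm fun j => hU _
  have hΔMm : Measurable ΔM := (measurable_randomSum (hN.measurable _) hU).sub
    (measurable_randomSum (hN.measurable _) hU)
  have hchar : ∀ n ξ, charFun (P.map (W n)) ξ =
      compoundPoissonExpCharFun (r.toNNReal * h : ℝ≥0) β ξ := by
    intro n ξ
    rw [charFun_apply_real, integral_map (hWm n).aemeasurable (by fun_prop)]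
    exact integral_cexp_shifted hβ hN hU hUl hUi hNU s h n ξ
  have hprob : ∀ n, IsProbabilityMeasure (P.map (W n)) := fun n =>
    Measure.isProbabilityMeasure_map (hWm n).aemeasurable
  have hlaw : ∀ n, P.map (W n) = P.map (W 0) := fun n =>
    Measure.ext_of_charFun (by ext ξ; rw [hchar, hchar])
  -- On the fiber `N s = n` the increment adds up the jumps from number `n` on.
  have hΔW : ∀ n, ∀ᵐ ω ∂P, N s ω = n → ΔM ω = W n ω := by
    intro n
    filter_upwards [hN.paths] with ω hω hn
    have hle : N s ω ≤ N (s + h) ω := hω.1 le_self_add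
    have e : N (s + h) ω = n + D ω := by simp only [hD]; omega
    simp only [hΔM, hW, randomSum, e, hn, Finset.sum_range_add, add_sub_cancel_left]
  -- Summing over the fibers `N s = n`: on each one the increment is `W n`, independent of the past
  -- and with a law free of `n`.
  have key : ∀ A B, MeasurableSet[E ⊔ ⨆ v : Iic s,
      MeasurableSpace.comap (randomSum (N v) U) inferInstance] A → MeasurableSet B →
      P (A ∩ ΔM ⁻¹' B) = P A * P.map (W 0) B := by
    intro A B hA hB
    have hAm : MeasurableSet A := (sup_le hE (iSup_le fun v => (measurable_randomSum
      (hN.measurable _) hU).comap_le) : _ ≤ mΩ) A hA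
    rw [measure_eq_tsum_inter_fiber (hN.measurable s) (hAm.inter (hΔMm hB)),
      measure_eq_tsum_inter_fiber (P := P) (hN.measurable s) hAm, ← ENNReal.tsum_mul_right]
    refine tsum_congr fun n => ?_
    obtain ⟨A', hA', hAA'⟩ := exists_measurableSet_past hN s n hA
    have hind := (Indep_iff _ _ _).1 (indep_past_future hN hU hUi hNU hE hENU s h n)
      (A' ∩ N s ⁻¹' {n}) (W n ⁻¹' B) ?_ ?_
    · rw [← hlaw n, Measure.map_apply (hWm n) hB]
      have e1 : P (A ∩ ΔM ⁻¹' B ∩ N s ⁻¹' {n}) = P (A' ∩ N s ⁻¹' {n} ∩ W n ⁻¹' B) := by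
        refine measure_congr (Filter.eventuallyEq_set.2 ?_)
        filter_upwards [hAA', hΔW n] with ω h1 h2
        simp only [mem_inter_iff, mem_preimage, mem_singleton_iff]
        constructor
        · rintro ⟨⟨ha, hb⟩, hn⟩
          exact ⟨⟨(h1 hn).1 ha, hn⟩, h2 hn ▸ hb⟩
        · rintro ⟨⟨ha, hn⟩, hb⟩
          exact ⟨⟨(h1 hn).2 ha, (h2 hn).symm ▸ hb⟩, hn⟩
      have e2 : P (A ∩ N s ⁻¹' {n}) = P (A' ∩ N s ⁻¹' {n}) := by
        refine measure_congr (Filter.eventuallyEq_set.2 ?_)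
        filter_upwards [hAA'] with ω h1
        simp only [mem_inter_iff, mem_preimage, mem_singleton_iff]
        exact and_congr_left h1
      rw [e1, e2, hind]
    · refine hA'.inter ?_
      refine ((le_iSup (fun v : Iic s => MeasurableSpace.comap (N v) _) ⟨s, le_refl s⟩).trans
        (le_sup_left.trans le_sup_right)) _ ?_
      exact ⟨{n}, measurableSet_singleton n, rfl⟩
    · have h1 : Measurable[MeasurableSpace.comap D inferInstance ⊔
          ⨆ i ∈ Ici n, MeasurableSpace.comap (U i) inferInstance] (W n) := by
        refine measurable_randomSum ((comap_measurable D).mono le_sup_left le_rfl) fun j => ?_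
        exact (comap_measurable (U (n + j))).mono
          ((le_iSup₂ (f := fun i (_ : i ∈ Ici n) => MeasurableSpace.comap (U i) _) (n + j)
            (Nat.le_add_right n j)).trans le_sup_right) le_rfl
      exact h1 hB
  -- The case `A = univ` of `key` identifies the law of the increment.
  have hΔlaw : P.map ΔM = P.map (W 0) := by
    ext B hB
    have := key univ B MeasurableSet.univ hB
    rwa [univ_inter, measure_univ, one_mul, ← Measure.map_apply hΔMm hB] at this
  refine ⟨(Indep_iff _ _ _).2 ?_, fun ξ => ?_⟩
  · rintro A _ hA ⟨B, hB, rfl⟩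
    rw [key A B hA hB, ← hΔlaw, Measure.map_apply hΔMm hB]
  · rw [← hchar 0 ξ, ← hΔlaw, charFun_apply_real, integral_map hΔMm.aemeasurable (by fun_prop)]

end OneSided

end

/-! ### Variation of constants along a path, through Riemann–Stieltjes sums -/

section

section Path

open Filter Topology

/-- The `i`-th point of the partition of `[s, s + t]` into `n + 1` intervals of equal length. -/
noncomputable def gridPoint (s t : ℝ) (n i : ℕ) : ℝ := s + i * (t / (n + 1))

theorem gridPoint_zero (s t : ℝ) (n : ℕ) : gridPoint s t n 0 = s := by simp [gridPoint]

theorem gridPoint_last (s t : ℝ) (n : ℕ) : gridPoint s t n (n + 1) = s + t := by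
  have : (n : ℝ) + 1 ≠ 0 := by positivity
  rw [gridPoint]
  push_cast
  rw [mul_div_cancel₀ _ this]

theorem gridPoint_succ (s t : ℝ) (n i : ℕ) :
    gridPoint s t n (i + 1) = gridPoint s t n i + t / (n + 1) := by
  simp only [gridPoint]
  push_cast
  ring

theorem gridPoint_mono {s t : ℝ} (ht : 0 ≤ t) (n : ℕ) : Monotone (gridPoint s t n) :=
  monotone_nat_of_le_succ fun i => by
    rw [gridPoint_succ]
    have : 0 ≤ t / (n + 1 : ℝ) := by positivity
    linarith

/-- The index of the interval of the partition that contains `u`. -/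
noncomputable def gridIndex (s t : ℝ) (n : ℕ) (u : ℝ) : ℕ := ⌊(u - s) / (t / (n + 1))⌋₊

theorem gridPoint_gridIndex_le {s t u : ℝ} (ht : 0 < t) (n : ℕ) (hu : s ≤ u) :
    gridPoint s t n (gridIndex s t n u) ≤ u := by
  have hd : 0 < t / (n + 1 : ℝ) := by positivity
  have h := Nat.floor_le (a := (u - s) / (t / (n + 1 : ℝ))) (div_nonneg (by linarith) hd.le)
  rw [le_div_iff₀ hd] at h
  simp only [gridPoint, gridIndex]
  linarith

theorem lt_gridPoint_gridIndex_succ {s t : ℝ} (ht : 0 < t) (n : ℕ) (u : ℝ) :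
    u < gridPoint s t n (gridIndex s t n u + 1) := by
  have hd : 0 < t / (n + 1 : ℝ) := by positivity
  have h := Nat.lt_floor_add_one ((u - s) / (t / (n + 1 : ℝ)))
  rw [div_lt_iff₀ hd] at h
  simp only [gridPoint, gridIndex]
  push_cast
  linarith

theorem gridIndex_eq {s t u : ℝ} (ht : 0 < t) {n i : ℕ} (h1 : gridPoint s t n i ≤ u)
    (h2 : u < gridPoint s t n (i + 1)) : gridIndex s t n u = i := by
  have hs : s ≤ u := by
    have := gridPoint_mono (s := s) ht.le n (Nat.zero_le i)
    rw [gridPoint_zero] at this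
    linarith
  have h3 := gridPoint_gridIndex_le ht n hs
  have h4 := lt_gridPoint_gridIndex_succ (s := s) ht n u
  have h5 : gridIndex s t n u < i + 1 :=
    (gridPoint_mono (s := s) ht.le n).reflect_lt (h3.trans_lt h2)
  have h6 : i < gridIndex s t n u + 1 :=
    (gridPoint_mono (s := s) ht.le n).reflect_lt (h1.trans_lt h4)
  omega

/-- The sum is a single integral over `[s, s + t]` in which `ψ` receives the endpoints of the cell
containing `u`; dominated convergence applies. The right endpoint tends to `u` strictly from the
right, so right-continuous data are admissible. -/
theorem tendsto_sum_integral_grid {E : Type*} [NormedAddCommGroup E] [NormedSpace ℝ E]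
    (ψ : ℝ → ℝ → ℝ → E) {s t C : ℝ} (ht : 0 < t)
    (hint : ∀ n i, i < n + 1 → IntervalIntegrable
      (ψ (gridPoint s t n i) (gridPoint s t n (i + 1))) volume
      (gridPoint s t n i) (gridPoint s t n (i + 1)))
    (hb : ∀ l r u, s ≤ l → l ≤ u → u < r → r ≤ s + t → ‖ψ l r u‖ ≤ C)
    (hlim : ∀ u, s ≤ u → u < s + t →
      Tendsto (fun q : ℝ × ℝ => ψ q.1 q.2 u) (𝓝[Icc s u] u ×ˢ 𝓝[>] u) (𝓝 0)) :
    Tendsto (fun n => ∑ i ∈ Finset.range (n + 1),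
      ∫ u in gridPoint s t n i..gridPoint s t n (i + 1),
        ψ (gridPoint s t n i) (gridPoint s t n (i + 1)) u) atTop (𝓝 0) := by
  let F : ℕ → ℝ → E := fun n u =>
    ψ (gridPoint s t n (gridIndex s t n u)) (gridPoint s t n (gridIndex s t n u + 1)) u
  -- `gridIndex` uses cells closed on the left while interval integrals use cells closed on the
  -- right, so the right endpoint is discarded.
  have hFae : ∀ n i, ∀ᵐ u, u ∈ uIoc (gridPoint s t n i) (gridPoint s t n (i + 1)) →
      ψ (gridPoint s t n i) (gridPoint s t n (i + 1)) u = F n u := by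
    intro n i
    filter_upwards [compl_mem_ae_iff.2 (measure_singleton (gridPoint s t n (i + 1)))] with u hu hu'
    rw [uIoc_of_le (gridPoint_mono ht.le n i.le_succ)] at hu'
    have : gridIndex s t n u = i := gridIndex_eq ht hu'.1.le (lt_of_le_of_ne hu'.2 hu)
    simp only [F, this]
  have hFint : ∀ n i, i < n + 1 →
      IntervalIntegrable (F n) volume (gridPoint s t n i) (gridPoint s t n (i + 1)) :=
    fun n i hi => (hint n i hi).congr_ae ((ae_restrict_iff' measurableSet_uIoc).2 (hFae n i))
  have hsum : ∀ n, ∑ i ∈ Finset.range (n + 1),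
      ∫ u in gridPoint s t n i..gridPoint s t n (i + 1),
        ψ (gridPoint s t n i) (gridPoint s t n (i + 1)) u = ∫ u in s..s + t, F n u := by
    intro n
    have h := intervalIntegral.sum_integral_adjacent_intervals (f := F n) (μ := volume)
      (a := gridPoint s t n) (n := n + 1) (hFint n)
    rw [gridPoint_zero, gridPoint_last] at h
    rw [← h]
    exact Finset.sum_congr rfl fun i _ => intervalIntegral.integral_congr_ae (hFae n i)
  simp_rw [hsum]
  have hFint' : ∀ n, IntervalIntegrable (F n) volume s (s + t) := by
    intro n
    have h := IntervalIntegrable.trans_iterate (f := F n) (μ := volume)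
      (a := gridPoint s t n) (n := n + 1) (hFint n)
    rwa [gridPoint_zero, gridPoint_last] at h
  have hae : ∀ᵐ u, u ∈ uIoc s (s + t) → s ≤ u ∧ u < s + t := by
    filter_upwards [compl_mem_ae_iff.2 (measure_singleton (s + t))] with u hu hu'
    rw [uIoc_of_le (by linarith)] at hu'
    exact ⟨hu'.1.le, lt_of_le_of_ne hu'.2 hu⟩
  have hsl : ∀ n i, s ≤ gridPoint s t n i := fun n i => by
    have := gridPoint_mono (s := s) ht.le n (Nat.zero_le i)
    rwa [gridPoint_zero] at this
  have h0 : (0 : E) = ∫ _ in s..s + t, (0 : E) := by simp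
  rw [h0]
  refine intervalIntegral.tendsto_integral_filter_of_dominated_convergence (fun _ => C)
    (Eventually.of_forall fun n => (hFint' n).def'.aestronglyMeasurable) ?_ (by simp) ?_
  · refine Eventually.of_forall fun n => ?_
    filter_upwards [hae] with u hu hu'
    obtain ⟨h1, h2⟩ := hu hu'
    have hl := gridPoint_gridIndex_le ht n h1
    refine hb _ _ _ (hsl n _) hl (lt_gridPoint_gridIndex_succ ht n u) ?_
    rw [← gridPoint_last s t n]
    refine gridPoint_mono ht.le n (Nat.succ_le_of_lt ?_)
    refine (gridPoint_mono (s := s) ht.le n).reflect_lt ?_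
    rw [gridPoint_last]
    linarith
  · filter_upwards [hae] with u hu hu'
    obtain ⟨h1, h2⟩ := hu hu'
    have hd : Tendsto (fun n : ℕ => t / ((n : ℝ) + 1)) atTop (𝓝 0) := by
      have := (tendsto_one_div_add_atTop_nhds_zero_nat (𝕜 := ℝ)).const_mul t
      simpa [div_eq_mul_inv] using this
    have hl : Tendsto (fun n => gridPoint s t n (gridIndex s t n u)) atTop (𝓝[Icc s u] u) := by
      refine tendsto_nhdsWithin_iff.2 ⟨?_, Eventually.of_forall fun n =>
        ⟨hsl n _, gridPoint_gridIndex_le ht n h1⟩⟩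
      refine tendsto_of_tendsto_of_tendsto_of_le_of_le (g := fun n : ℕ => u - t / ((n : ℝ) + 1))
        (by simpa using hd.const_sub u) tendsto_const_nhds (fun n => ?_)
        (fun n => gridPoint_gridIndex_le ht n h1)
      have := lt_gridPoint_gridIndex_succ (s := s) ht n u
      rw [gridPoint_succ] at this
      dsimp only
      linarith
    have hr : Tendsto (fun n => gridPoint s t n (gridIndex s t n u + 1)) atTop (𝓝[>] u) := by
      refine tendsto_nhdsWithin_iff.2 ⟨?_, Eventually.of_forall fun n =>
        lt_gridPoint_gridIndex_succ ht n u⟩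
      simp_rw [gridPoint_succ]
      simpa using (tendsto_nhds_of_tendsto_nhdsWithin hl).add hd
    exact (hlim u h1 h2).comp (hl.prodMk hr)

theorem tendsto_riemann_sum {E : Type*} [NormedAddCommGroup E] [NormedSpace ℝ E] [CompleteSpace E]
    {g : ℝ → E} (hg : Continuous g) {s t : ℝ} (ht : 0 < t) :
    Tendsto (fun n : ℕ => ∑ i ∈ Finset.range (n + 1), (t / (n + 1)) • g (gridPoint s t n i)) atTop
      (𝓝 (∫ u in s..s + t, g u)) := by
  obtain ⟨C, hC⟩ := isCompact_Icc.exists_bound_of_continuousOn (s := Icc s (s + t)) hg.continuousOn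
  have h := tendsto_sum_integral_grid (fun l _ u => g l - g u) (s := s) (C := C + C) ht
    (fun n i _ => (Continuous.intervalIntegrable (by fun_prop) _ _)) ?_ ?_
  · have h2 : Tendsto (fun n : ℕ => (∑ i ∈ Finset.range (n + 1),
        ∫ u in gridPoint s t n i..gridPoint s t n (i + 1), (g (gridPoint s t n i) - g u)) +
        ∫ u in s..s + t, g u) atTop (𝓝 (0 + ∫ u in s..s + t, g u)) := h.add_const _
    rw [zero_add] at h2
    refine h2.congr fun n => ?_
    have h3 := intervalIntegral.sum_integral_adjacent_intervals (f := g) (μ := volume)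
      (a := gridPoint s t n) (n := n + 1) (fun i _ => hg.intervalIntegrable _ _)
    rw [gridPoint_zero, gridPoint_last] at h3
    rw [← h3, ← Finset.sum_add_distrib]
    refine Finset.sum_congr rfl fun i _ => ?_
    rw [intervalIntegral.integral_sub (by simp) (hg.intervalIntegrable _ _), sub_add_cancel,
      intervalIntegral.integral_const, gridPoint_succ, add_sub_cancel_left]
  · intro l r u h1 h2 h3 h4
    exact (norm_sub_le _ _).trans (add_le_add (hC l ⟨h1, by linarith⟩) (hC u ⟨by linarith, by linarith⟩))
  · intro u _ _
    have h1 : Tendsto (fun q : ℝ × ℝ => g q.1 - g u) (𝓝[Icc s u] u ×ˢ 𝓝[>] u)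
        (𝓝 (g u - g u)) :=
      (((hg.tendsto u).mono_left nhdsWithin_le_nhds).comp tendsto_fst).sub_const _
    rwa [sub_self] at h1

/-- Summation by parts. With `E u = exp (-k (s + t - u))`, the equation gives `E l (z r - z l) = E l
(x r - x l + k ∫ x)` on a cell `[l, r]`, and `E r x r - E l x l` telescopes to the limit. The
discrepancy on a cell is the integral of `k (E u x r - E l x u)`, whose integrand tends to `0`
because `E` is continuous and `x` is right-continuous. -/
theorem tendsto_sum_exp_mul_increment {x z : ℝ → ℝ} {k ξ s t C : ℝ} (ht : 0 ≤ t)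
    (hx : ∀ u, s ≤ u → IntervalIntegrable x volume s u)
    (heq : ∀ u, s ≤ u → x u = ξ - k * (∫ v in s..u, x v) + (z u - z s))
    (hz : ∀ u, s ≤ u → ContinuousWithinAt z (Ici u) u)
    (hzb : ∀ u, s ≤ u → u ≤ s + t → |z u| ≤ C) :
    Tendsto (fun n => ∑ i ∈ Finset.range (n + 1), Real.exp (-(k * (s + t - gridPoint s t n i))) *
      (z (gridPoint s t n (i + 1)) - z (gridPoint s t n i))) atTop
      (𝓝 (x (s + t) - Real.exp (-(k * t)) * x s)) := by
  rcases ht.eq_or_lt with rfl | ht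
  · simp [gridPoint]
  have hsub : ∀ u v, s ≤ u → u ≤ v → IntervalIntegrable x volume u v := fun u v hu huv =>
    (hx u hu).symm.trans (hx v (hu.trans huv))
  -- boundedness and right continuity of `x`
  have hcont : ContinuousOn (fun u => ∫ v in s..u, x v) (Icc s (s + t)) := by
    have := intervalIntegral.continuousOn_primitive_interval (μ := volume) (f := x) (a := s)
      (b := s + t) (by
        rw [uIcc_of_le (by linarith), ← intervalIntegrable_iff_integrableOn_Icc_of_le (by linarith)]
        exact hx _ (by linarith))
    rwa [uIcc_of_le (by linarith)] at this
  obtain ⟨B, hB⟩ := isCompact_Icc.exists_bound_of_continuousOn hcont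
  obtain ⟨K, hK⟩ : ∃ K, ∀ u, s ≤ u → u ≤ s + t → |x u| ≤ K := by
    refine ⟨|ξ| + |k| * B + (C + C), fun u h1 h2 => ?_⟩
    rw [heq u h1]
    have e1 := hB u ⟨h1, h2⟩
    have e2 := hzb u h1 h2
    have e3 := hzb s le_rfl (by linarith)
    rw [Real.norm_eq_abs] at e1
    calc |ξ - k * (∫ v in s..u, x v) + (z u - z s)|
        ≤ |ξ| + |k * ∫ v in s..u, x v| + (|z u| + |z s|) :=
          (abs_add_le _ _).trans (add_le_add (abs_sub _ _) (abs_sub _ _))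
      _ ≤ _ := by rw [abs_mul]; gcongr
  -- `x` inherits right continuity from `z` through the equation, the integral term being
  -- continuous.
  have hright : ∀ u, s ≤ u → u < s + t → Tendsto x (𝓝[>] u) (𝓝 (x u)) := by
    intro u h1 h2
    have hc1 : Tendsto (fun w => ∫ v in s..w, x v) (𝓝[>] u) (𝓝 (∫ v in s..u, x v)) := by
      refine (hcont u ⟨h1, h2.le⟩).mono_left ?_
      rw [← nhdsWithin_Ioo_eq_nhdsGT h2]
      exact nhdsWithin_mono _ fun w hw => ⟨h1.trans hw.1.le, hw.2.le⟩
    have hc2 : Tendsto z (𝓝[>] u) (𝓝 (z u)) :=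
      (hz u h1).mono_left (nhdsWithin_mono _ Ioi_subset_Ici_self)
    have hc := ((hc1.const_mul k).const_sub ξ).add (hc2.sub_const (z s))
    rw [← heq u h1] at hc
    refine hc.congr' ?_
    filter_upwards [self_mem_nhdsWithin] with w hw using (heq w (h1.trans (le_of_lt hw))).symm
  let E : ℝ → ℝ := fun u => Real.exp (-(k * (s + t - u)))
  have hE : Continuous E := by fun_prop
  obtain ⟨M, hM⟩ := isCompact_Icc.exists_bound_of_continuousOn (s := Icc s (s + t)) hE.continuousOn
  have hgs : ∀ n i, s ≤ gridPoint s t n i := fun n i => by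
    have := gridPoint_mono (s := s) ht.le n (Nat.zero_le i)
    rwa [gridPoint_zero] at this
  have hle : ∀ n i, gridPoint s t n i ≤ gridPoint s t n (i + 1) := fun n i =>
    gridPoint_mono ht.le n i.le_succ
  have h := tendsto_sum_integral_grid (fun l r u => k * (E u * x r - E l * x u)) (s := s)
    (C := |k| * (M * K + M * K)) ht ?_ ?_ ?_
  · have h2 : Tendsto (fun n => (x (s + t) - Real.exp (-(k * t)) * x s) - _) atTop
      (𝓝 ((x (s + t) - Real.exp (-(k * t)) * x s) - 0)) := h.const_sub _
    rw [sub_zero] at h2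
    refine h2.congr fun n => ?_
    have htel := Finset.sum_range_sub (fun i => E (gridPoint s t n i) * x (gridPoint s t n i)) (n + 1)
    simp only [gridPoint_zero, gridPoint_last] at htel
    have hEs : E s = Real.exp (-(k * t)) := by simp only [E, add_sub_cancel_left]
    have hEt : E (s + t) = 1 := by simp [E]
    rw [hEs, hEt, one_mul] at htel
    rw [← htel, ← Finset.sum_sub_distrib]
    refine Finset.sum_congr rfl fun i _ => ?_
    set l := gridPoint s t n i
    set r := gridPoint s t n (i + 1)
    have hsl : s ≤ l := hgs n i
    have hlr : l ≤ r := hle n i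
    have i1 : ∫ u in l..r, k * E u = E r - E l := by
      refine intervalIntegral.integral_eq_sub_of_hasDerivAt (fun u _ => ?_)
        ((hE.const_mul k).intervalIntegrable _ _)
      have hd : HasDerivAt (fun u => -(k * (s + t - u))) k u := by
        simpa using! (((hasDerivAt_id u).const_sub (s + t)).const_mul k).neg
      exact hd.exp.congr_deriv (mul_comm _ _)
    have i2 : ∫ v in s..r, x v = (∫ v in s..l, x v) + ∫ v in l..r, x v :=
      (intervalIntegral.integral_add_adjacent_intervals (hx l hsl) (hsub l r hsl hlr)).symm
    have i3 : ∫ u in l..r, k * (E u * x r - E l * x u) =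
        (E r - E l) * x r - E l * (k * ∫ v in l..r, x v) := by
      have : ∀ u, k * (E u * x r - E l * x u) = k * E u * x r - E l * k * x u := fun u => by ring
      simp_rw [this]
      rw [intervalIntegral.integral_sub
        (Continuous.intervalIntegrable (by fun_prop) _ _)
        ((hsub l r hsl hlr).const_mul _), intervalIntegral.integral_mul_const, i1,
        intervalIntegral.integral_const_mul]
      ring
    have hxr := heq r (hsl.trans hlr)
    have hxl := heq l hsl
    rw [i3]
    have : E l * (z r - z l) = E l * (x r - x l + k * ∫ v in l..r, x v) := by
      rw [hxr, hxl, i2]; ring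
    change _ = E l * (z r - z l)
    rw [this]
    ring
  · intro n i _
    exact ((((hE.mul continuous_const).intervalIntegrable _ _).sub
      ((hsub _ _ (hgs n i) (hle n i)).const_mul _)).const_mul k)
  · intro l r u h1 h2 h3 h4
    have a1 := hM u ⟨by linarith, by linarith⟩
    have a2 := hM l ⟨h1, by linarith⟩
    have a3 := hK r (by linarith) h4
    have a4 := hK u (by linarith) (by linarith)
    have hM0 : 0 ≤ M := (norm_nonneg _).trans a1
    rw [Real.norm_eq_abs, abs_mul]
    refine mul_le_mul_of_nonneg_left ((abs_sub _ _).trans ?_) (abs_nonneg k)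
    rw [abs_mul, abs_mul]
    exact add_le_add (mul_le_mul a1 a3 (abs_nonneg _) hM0) (mul_le_mul a2 a4 (abs_nonneg _) hM0)
  · intro u h1 h2
    have hl : Tendsto (fun q : ℝ × ℝ => E q.1) (𝓝[Icc s u] u ×ˢ 𝓝[>] u) (𝓝 (E u)) :=
      ((hE.tendsto u).mono_left nhdsWithin_le_nhds).comp tendsto_fst
    have hr : Tendsto (fun q : ℝ × ℝ => x q.2) (𝓝[Icc s u] u ×ˢ 𝓝[>] u) (𝓝 (x u)) :=
      (hright u h1 h2).comp tendsto_snd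
    have := ((hr.const_mul (E u)).sub (hl.mul_const (x u))).const_mul k
    simpa using this

end Path

end

/-! ### The limiting characteristic exponent and the increments of the driver -/

section

open Filter Topology

theorem integral_exp_ornsteinUhlenbeck_exponent {k β : ℝ} (hk : 0 < k) (hβ : 0 < β)
    (l ξ s t : ℝ) :
    ∫ u in s..s + t, (l : ℂ) * ((β : ℂ) / (β - ((ξ * Real.exp (-(k * (s + t - u))) : ℝ) : ℂ) *
      Complex.I) - 1) = ((l / k : ℝ) : ℂ) * (Complex.log (β - Real.exp (-(k * t)) * ξ * Complex.I) -
        Complex.log (β - ξ * Complex.I)) := by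
  let e : ℝ → ℝ := fun u => ξ * Real.exp (-(k * (s + t - u)))
  have hre : ∀ y : ℝ, 0 < ((β : ℂ) - y * Complex.I).re := fun y => by simpa using hβ
  have hne : ∀ y : ℝ, (β : ℂ) - y * Complex.I ≠ 0 := fun y h => by
    have := hre y
    simp [h] at this
  have hk0 : (k : ℂ) ≠ 0 := by exact_mod_cast hk.ne'
  -- Since `e' = k e`, differentiating the logarithm gives `l * (i e / (β - i e)) = l * (β / (β - i
  -- e) - 1)`. The argument has real part `β > 0` and so avoids the branch cut.
  have hderiv : ∀ u ∈ uIcc s (s + t), HasDerivAt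
      (fun u => -(((l / k : ℝ) : ℂ) * Complex.log (β - (e u : ℂ) * Complex.I)))
      ((l : ℂ) * ((β : ℂ) / (β - (e u : ℂ) * Complex.I) - 1)) u := by
    intro u _
    have h1 : HasDerivAt (fun u => -(k * (s + t - u))) k u := by
      simpa using! (((hasDerivAt_id u).const_sub (s + t)).const_mul k).neg
    have h2 : HasDerivAt e (e u * k) u := (h1.exp.const_mul ξ).congr_deriv (by simp only [e]; ring)
    have h3 := ((h2.ofReal_comp.mul_const Complex.I).const_sub (β : ℂ)).clog_real
      (Or.inl (hre (e u)))
    refine (h3.const_mul ((l / k : ℝ) : ℂ)).neg.congr_deriv ?_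
    have := hne (e u)
    push_cast
    field_simp
    ring
  have hcont : Continuous fun u : ℝ => (l : ℂ) * ((β : ℂ) / (β - (e u : ℂ) * Complex.I) - 1) := by
    have he : Continuous e := by fun_prop
    exact continuous_const.mul ((continuous_const.div (by fun_prop) fun u => hne (e u)).sub
      continuous_const)
  rw [intervalIntegral.integral_eq_sub_of_hasDerivAt hderiv (hcont.intervalIntegrable _ _)]
  simp only [e, sub_self, mul_zero, neg_zero, Real.exp_zero, mul_one, add_sub_cancel_left]
  push_cast
  ring_nf

theorem tendsto_prod_compoundPoissonExpCharFun {k β t : ℝ} (hk : 0 < k) (hβ : 0 < β) (ht : 0 < t)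
    (l ξ s : ℝ) :
    Tendsto (fun n : ℕ => ∏ i ∈ Finset.range (n + 1), compoundPoissonExpCharFun (l * (t / (n + 1))) β
      (ξ * Real.exp (-(k * (s + t - gridPoint s t n i))))) atTop
      (𝓝 (polyaErlangCharFun (Real.exp (-(k * t))) (l / k) β ξ)) := by
  have hne : ∀ y : ℝ, (β : ℂ) - y * Complex.I ≠ 0 := fun y h => by
    have : 0 < ((β : ℂ) - y * Complex.I).re := by simpa using hβ
    simp [h] at this
  have hcont : Continuous fun u : ℝ => (l : ℂ) * ((β : ℂ) /
      (β - ((ξ * Real.exp (-(k * (s + t - u))) : ℝ) : ℂ) * Complex.I) - 1) :=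
    continuous_const.mul ((continuous_const.div (by fun_prop) fun u => hne _).sub
      continuous_const)
  have h := tendsto_riemann_sum hcont (s := s) ht
  rw [integral_exp_ornsteinUhlenbeck_exponent hk hβ] at h
  refine ((Complex.continuous_exp.tendsto _).comp h).congr fun n => ?_
  simp only [compoundPoissonExpCharFun, Function.comp_apply]
  rw [← Complex.exp_sum]
  congr 1
  refine Finset.sum_congr rfl fun i _ => ?_
  rw [Complex.real_smul]
  push_cast
  ring

variable {Ω : Type*} [mΩ : MeasurableSpace Ω] {P : Measure Ω}

theorem indep_integral_mul {Ω : Type*} {m₁ m₂ mΩ : MeasurableSpace Ω} {P : Measure Ω}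
    (h₁ : m₁ ≤ mΩ) (h₂ : m₂ ≤ mΩ) (h : Indep m₁ m₂ P) {f g : Ω → ℂ}
    (hf : Measurable[m₁] f) (hg : Measurable[m₂] g) :
    ∫ ω, f ω * g ω ∂P = (∫ ω, f ω ∂P) * ∫ ω, g ω ∂P := by
  have hi : IndepFun f g P := by
    rw [IndepFun_iff_Indep]
    exact indep_of_indep_of_le_left (indep_of_indep_of_le_right h hg.comap_le) hf.comap_le
  exact hi.integral_fun_mul_eq_mul_integral (hf.mono h₁ le_rfl).aestronglyMeasurable
    (hg.mono h₂ le_rfl).aestronglyMeasurable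

/-- The information on the initial value and on the two compound sums up to time `s`. -/
noncomputable abbrev driverPast (X₀ : Ω → ℝ) (N₁ : ℝ≥0 → Ω → ℕ) (U : ℕ → Ω → ℝ) (N₂ : ℝ≥0 → Ω → ℕ)
    (D : ℕ → Ω → ℝ) (s : ℝ≥0) : MeasurableSpace Ω :=
  MeasurableSpace.comap X₀ inferInstance ⊔
    ((⨆ v : Iic s, MeasurableSpace.comap (randomSum (N₁ v) U) inferInstance) ⊔
      ⨆ v : Iic s, MeasurableSpace.comap (randomSum (N₂ v) D) inferInstance)

section Driver

variable {l₁ β₁ l₂ β₂ : ℝ} {X₀ : Ω → ℝ} {N₁ : ℝ≥0 → Ω → ℕ} {U : ℕ → Ω → ℝ}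
  {N₂ : ℝ≥0 → Ω → ℕ} {D : ℕ → Ω → ℝ}

omit mΩ in
theorem driverPast_mono : Monotone (driverPast X₀ N₁ U N₂ D) := fun _ u hsu =>
  sup_le_sup le_rfl (sup_le_sup
    (iSup_le fun v => le_iSup (fun w : Iic u => MeasurableSpace.comap (randomSum (N₁ w) U) _)
      ⟨v, v.2.trans hsu⟩)
    (iSup_le fun v => le_iSup (fun w : Iic u => MeasurableSpace.comap (randomSum (N₂ w) D) _)
      ⟨v, v.2.trans hsu⟩))

omit mΩ in
theorem measurable_initial_driverPast (s : ℝ≥0) : Measurable[driverPast X₀ N₁ U N₂ D s] X₀ :=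
  (comap_measurable X₀).mono le_sup_left le_rfl

omit mΩ in
theorem measurable_bilateralCompoundSum_driverPast {s v : ℝ≥0} (hv : v ≤ s) :
    Measurable[driverPast X₀ N₁ U N₂ D s] (bilateralCompoundSum N₁ U N₂ D v) := by
  have h1 : Measurable[driverPast X₀ N₁ U N₂ D s] (randomSum (N₁ v) U) :=
    (comap_measurable (randomSum (N₁ v) U)).mono
      ((le_iSup (fun w : Iic s => MeasurableSpace.comap (randomSum (N₁ w) U) _) ⟨v, hv⟩).trans
        (le_sup_left.trans le_sup_right)) le_rfl
  have h2 : Measurable[driverPast X₀ N₁ U N₂ D s] (randomSum (N₂ v) D) :=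
    (comap_measurable (randomSum (N₂ v) D)).mono
      ((le_iSup (fun w : Iic s => MeasurableSpace.comap (randomSum (N₂ w) D) _) ⟨v, hv⟩).trans
        (le_sup_right.trans le_sup_right)) le_rfl
  exact h1.sub h2

variable (hZ : IsBilateralExpDriver P l₁ β₁ l₂ β₂ X₀ N₁ U N₂ D)
include hZ

theorem driverPast_le (s : ℝ≥0) : driverPast X₀ N₁ U N₂ D s ≤ mΩ :=
  sup_le hZ.init.comap_le (sup_le
    (iSup_le fun v => (measurable_randomSum (hZ.poisson_up.measurable v)
      hZ.measurable_up).comap_le)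
    (iSup_le fun v => (measurable_randomSum (hZ.poisson_down.measurable v)
      hZ.measurable_down).comap_le))

theorem indep_driver (i j : Fin 5) (hij : i ≠ j) :
    Indep (![MeasurableSpace.comap X₀ inferInstance,
      ⨆ t, MeasurableSpace.comap (N₁ t) inferInstance,
      ⨆ n, MeasurableSpace.comap (U n) inferInstance,
      ⨆ t, MeasurableSpace.comap (N₂ t) inferInstance,
      ⨆ m, MeasurableSpace.comap (D m) inferInstance] i)
      (![MeasurableSpace.comap X₀ inferInstance,
      ⨆ t, MeasurableSpace.comap (N₁ t) inferInstance,
      ⨆ n, MeasurableSpace.comap (U n) inferInstance,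
      ⨆ t, MeasurableSpace.comap (N₂ t) inferInstance,
      ⨆ m, MeasurableSpace.comap (D m) inferInstance] j) P := hZ.indep.indep hij

/-- For each side, the initial value together with the opposite side serves as `E` in
`indep_compound_increment`. -/
theorem indep_driver_sup :
    Indep (MeasurableSpace.comap X₀ inferInstance ⊔
        ((⨆ t, MeasurableSpace.comap (N₂ t) inferInstance) ⊔
          ⨆ n, MeasurableSpace.comap (D n) inferInstance))
      ((⨆ t, MeasurableSpace.comap (N₁ t) inferInstance) ⊔
        ⨆ n, MeasurableSpace.comap (U n) inferInstance) P ∧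
    Indep (MeasurableSpace.comap X₀ inferInstance ⊔
        ((⨆ t, MeasurableSpace.comap (N₁ t) inferInstance) ⊔
          ⨆ n, MeasurableSpace.comap (U n) inferInstance))
      ((⨆ t, MeasurableSpace.comap (N₂ t) inferInstance) ⊔
        ⨆ n, MeasurableSpace.comap (D n) inferInstance) P := by
  have h_le : ∀ i : Fin 5, ![MeasurableSpace.comap X₀ inferInstance,
      ⨆ t, MeasurableSpace.comap (N₁ t) inferInstance,
      ⨆ n, MeasurableSpace.comap (U n) inferInstance,
      ⨆ t, MeasurableSpace.comap (N₂ t) inferInstance,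
      ⨆ m, MeasurableSpace.comap (D m) inferInstance] i ≤ mΩ := by
    intro i
    fin_cases i
    · exact hZ.init.comap_le
    · exact iSup_le fun v => (hZ.poisson_up.measurable v).comap_le
    · exact iSup_le fun v => (hZ.measurable_up v).comap_le
    · exact iSup_le fun v => (hZ.poisson_down.measurable v).comap_le
    · exact iSup_le fun v => (hZ.measurable_down v).comap_le
  constructor
  · refine indep_of_indep_of_le_left (indep_of_indep_of_le_right
      (indep_iSup_of_disjoint h_le hZ.indep (S := {0, 3, 4}) (T := {1, 2}) (by simp)) ?_) ?_
    · exact sup_le (le_iSup₂_of_le 1 (by simp) le_rfl) (le_iSup₂_of_le 2 (by simp) le_rfl)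
    · exact sup_le (le_iSup₂_of_le 0 (by simp) le_rfl) (sup_le (le_iSup₂_of_le 3 (by simp) le_rfl)
        (le_iSup₂_of_le 4 (by simp) le_rfl))
  · refine indep_of_indep_of_le_left (indep_of_indep_of_le_right
      (indep_iSup_of_disjoint h_le hZ.indep (S := {0, 1, 2}) (T := {3, 4}) (by simp)) ?_) ?_
    · exact sup_le (le_iSup₂_of_le 3 (by simp) le_rfl) (le_iSup₂_of_le 4 (by simp) le_rfl)
    · exact sup_le (le_iSup₂_of_le 0 (by simp) le_rfl) (sup_le (le_iSup₂_of_le 1 (by simp) le_rfl)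
        (le_iSup₂_of_le 2 (by simp) le_rfl))

omit hZ in
omit mΩ in
theorem measurable_randomSum_iSup {m : MeasurableSpace Ω} {N : ℝ≥0 → Ω → ℕ} {V : ℕ → Ω → ℝ}
    (h : (⨆ t, MeasurableSpace.comap (N t) inferInstance) ⊔
      (⨆ n, MeasurableSpace.comap (V n) inferInstance) ≤ m) (t : ℝ≥0) :
    Measurable (randomSum (N t) V) :=
  measurable_randomSum
    ((comap_measurable (N t)).mono ((le_iSup (fun t => MeasurableSpace.comap (N t) _) t).trans
      (le_sup_left.trans h)) le_rfl)
    fun n => (comap_measurable (V n)).mono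
      ((le_iSup (fun n => MeasurableSpace.comap (V n) _) n).trans (le_sup_right.trans h)) le_rfl

theorem integral_mul_cexp_increment [IsProbabilityMeasure P] (hβ₁ : 0 < β₁) (hβ₂ : 0 < β₂)
    (s h : ℝ≥0) {f : Ω → ℂ} (hf : Measurable[driverPast X₀ N₁ U N₂ D s] f) (ξ : ℝ) :
    ∫ ω, f ω * Complex.exp (ξ * ((bilateralCompoundSum N₁ U N₂ D (s + h) ω -
      bilateralCompoundSum N₁ U N₂ D s ω : ℝ) : ℂ) * Complex.I) ∂P =
      (∫ ω, f ω ∂P) * (compoundPoissonExpCharFun (l₁.toNNReal * h : ℝ≥0) β₁ ξ *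
        compoundPoissonExpCharFun (l₂.toNNReal * h : ℝ≥0) β₂ (-ξ)) := by
  have hm₁ : ∀ v, Measurable (randomSum (N₁ v) U) := fun v =>
    measurable_randomSum (hZ.poisson_up.measurable v) hZ.measurable_up
  have hm₂ : ∀ v, Measurable (randomSum (N₂ v) D) := fun v =>
    measurable_randomSum (hZ.poisson_down.measurable v) hZ.measurable_down
  have hσN₁ : ⨆ t, MeasurableSpace.comap (N₁ t) inferInstance ≤ mΩ :=
    iSup_le fun v => (hZ.poisson_up.measurable v).comap_le
  have hσU : ⨆ t, MeasurableSpace.comap (U t) inferInstance ≤ mΩ :=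
    iSup_le fun v => (hZ.measurable_up v).comap_le
  have hσN₂ : ⨆ t, MeasurableSpace.comap (N₂ t) inferInstance ≤ mΩ :=
    iSup_le fun v => (hZ.poisson_down.measurable v).comap_le
  have hσD : ⨆ t, MeasurableSpace.comap (D t) inferInstance ≤ mΩ :=
    iSup_le fun v => (hZ.measurable_down v).comap_le
  have hE₁ := sup_le hZ.init.comap_le (sup_le hσN₂ hσD)
  have hE₂ := sup_le hZ.init.comap_le (sup_le hσN₁ hσU)
  obtain ⟨hi₁, hc₁⟩ := indep_compound_increment hβ₁ hZ.poisson_up hZ.measurable_up hZ.law_up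
    hZ.indep_up (indep_driver hZ 1 2 (by decide)) hE₁ (indep_driver_sup hZ).1 s h
  obtain ⟨hi₂, hc₂⟩ := indep_compound_increment hβ₂ hZ.poisson_down hZ.measurable_down hZ.law_down
    hZ.indep_down (indep_driver hZ 3 4 (by decide)) hE₂ (indep_driver_sup hZ).2 s h
  let e₁ : Ω → ℂ := fun ω => Complex.exp (ξ *
    ((randomSum (N₁ (s + h)) U ω - randomSum (N₁ s) U ω : ℝ) : ℂ) * Complex.I)
  let e₂ : Ω → ℂ := fun ω => Complex.exp ((-ξ : ℝ) *
    ((randomSum (N₂ (s + h)) D ω - randomSum (N₂ s) D ω : ℝ) : ℂ) * Complex.I)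
  have hexp : Measurable fun p : ℝ => Complex.exp (ξ * (p : ℂ) * Complex.I) := by fun_prop
  have hexp' : Measurable fun p : ℝ => Complex.exp ((-ξ : ℝ) * (p : ℂ) * Complex.I) := by fun_prop
  have me₁ : Measurable[MeasurableSpace.comap (fun ω => randomSum (N₁ (s + h)) U ω -
      randomSum (N₁ s) U ω) inferInstance] e₁ := hexp.comp (comap_measurable fun ω => randomSum (N₁ (s + h)) U ω -
    randomSum (N₁ s) U ω)
  have me₂ : Measurable[MeasurableSpace.comap (fun ω => randomSum (N₂ (s + h)) D ω -
      randomSum (N₂ s) D ω) inferInstance] e₂ := hexp'.comp (comap_measurable fun ω => randomSum (N₂ (s + h)) D ω -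
    randomSum (N₂ s) D ω)
  have hp₁ : ⨆ v : Iic s, MeasurableSpace.comap (randomSum (N₁ v) U) inferInstance ≤
      (⨆ t, MeasurableSpace.comap (N₁ t) inferInstance) ⊔
        ⨆ n, MeasurableSpace.comap (U n) inferInstance :=
    iSup_le fun v => (measurable_randomSum_iSup le_rfl (v : ℝ≥0)).comap_le
  have hp₂ : ⨆ v : Iic s, MeasurableSpace.comap (randomSum (N₂ v) D) inferInstance ≤
      (⨆ t, MeasurableSpace.comap (N₂ t) inferInstance) ⊔
        ⨆ n, MeasurableSpace.comap (D n) inferInstance :=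
    iSup_le fun v => (measurable_randomSum_iSup le_rfl (v : ℝ≥0)).comap_le
  have hG₁ : driverPast X₀ N₁ U N₂ D s ≤ (MeasurableSpace.comap X₀ inferInstance ⊔
        ((⨆ t, MeasurableSpace.comap (N₂ t) inferInstance) ⊔
          ⨆ n, MeasurableSpace.comap (D n) inferInstance)) ⊔
        ⨆ v : Iic s, MeasurableSpace.comap (randomSum (N₁ v) U) inferInstance :=
    sup_le (le_sup_left.trans le_sup_left) (sup_le le_sup_right
      (hp₂.trans (le_sup_right.trans le_sup_left)))
  have hG₂ : driverPast X₀ N₁ U N₂ D s ≤ (MeasurableSpace.comap X₀ inferInstance ⊔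
        ((⨆ t, MeasurableSpace.comap (N₁ t) inferInstance) ⊔
          ⨆ n, MeasurableSpace.comap (U n) inferInstance)) ⊔
        ⨆ v : Iic s, MeasurableSpace.comap (randomSum (N₂ v) D) inferInstance :=
    sup_le (le_sup_left.trans le_sup_left) (sup_le (hp₁.trans (le_sup_right.trans le_sup_left))
      le_sup_right)
  have hsplit : ∀ ω, f ω * Complex.exp (ξ * ((bilateralCompoundSum N₁ U N₂ D (s + h) ω -
      bilateralCompoundSum N₁ U N₂ D s ω : ℝ) : ℂ) * Complex.I) = f ω * e₂ ω * e₁ ω := by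
    intro ω
    simp only [e₁, e₂]
    rw [mul_assoc (f ω), ← Complex.exp_add]
    congr 2
    simp only [bilateralCompoundSum, randomSum]
    push_cast
    ring
  have hlast : (MeasurableSpace.comap X₀ inferInstance ⊔
        ((⨆ t, MeasurableSpace.comap (N₂ t) inferInstance) ⊔
          ⨆ n, MeasurableSpace.comap (D n) inferInstance)) ⊔
        ⨆ v : Iic s, MeasurableSpace.comap (randomSum (N₁ v) U) inferInstance ≤ mΩ :=
    sup_le hE₁ (hp₁.trans (sup_le hσN₁ hσU))
  have hlast' : (MeasurableSpace.comap X₀ inferInstance ⊔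
        ((⨆ t, MeasurableSpace.comap (N₁ t) inferInstance) ⊔
          ⨆ n, MeasurableSpace.comap (U n) inferInstance)) ⊔
        ⨆ v : Iic s, MeasurableSpace.comap (randomSum (N₂ v) D) inferInstance ≤ mΩ :=
    sup_le hE₂ (hp₂.trans (sup_le hσN₂ hσD))
  have hΔ₂ : Measurable[(MeasurableSpace.comap X₀ inferInstance ⊔
        ((⨆ t, MeasurableSpace.comap (N₂ t) inferInstance) ⊔
          ⨆ n, MeasurableSpace.comap (D n) inferInstance)) ⊔
        ⨆ v : Iic s, MeasurableSpace.comap (randomSum (N₁ v) U) inferInstance] e₂ :=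
    hexp'.comp ((measurable_randomSum_iSup (le_sup_right.trans le_sup_left) (s + h)).sub
      (measurable_randomSum_iSup (le_sup_right.trans le_sup_left) s))
  simp_rw [hsplit]
  -- The upward increment is split off first, its `E` containing the whole downward side and hence
  -- `e₂`; the downward increment is then split off from `f`.
  rw [indep_integral_mul (f := fun ω => f ω * e₂ ω) (g := e₁) hlast
      ((hm₁ _).sub (hm₁ _)).comap_le hi₁ ((hf.mono hG₁ le_rfl).mul hΔ₂) me₁,
    indep_integral_mul (f := f) (g := e₂) hlast' ((hm₂ _).sub (hm₂ _)).comap_le hi₂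
      (hf.mono hG₂ le_rfl) me₂,
    ← hc₁ ξ, ← hc₂ (-ξ)]
  ring

/-- Induction from the last increment: everything before it is measurable for the past at `s + n *
h` and plays the part of `f`. -/
theorem integral_mul_cexp_sum_increment [IsProbabilityMeasure P] (hβ₁ : 0 < β₁) (hβ₂ : 0 < β₂)
    (s h : ℝ≥0) {f : Ω → ℂ} (hf : Measurable[driverPast X₀ N₁ U N₂ D s] f) (c : ℕ → ℝ) (ξ : ℝ)
    (n : ℕ) :
    ∫ ω, f ω * Complex.exp (ξ * ((∑ i ∈ Finset.range n, c i *
      (bilateralCompoundSum N₁ U N₂ D (s + (i + 1 : ℕ) * h) ω -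
        bilateralCompoundSum N₁ U N₂ D (s + i * h) ω) : ℝ) : ℂ) * Complex.I) ∂P =
      (∫ ω, f ω ∂P) * ∏ i ∈ Finset.range n,
        (compoundPoissonExpCharFun (l₁.toNNReal * h : ℝ≥0) β₁ (ξ * c i) *
        compoundPoissonExpCharFun (l₂.toNNReal * h : ℝ≥0) β₂ (-(ξ * c i))) := by
  induction n with
  | zero => simp
  | succ n ih =>
    rw [Finset.prod_range_succ, ← mul_assoc, ← ih]
    have hsn : s ≤ s + n * h := le_self_add
    have hS : Measurable[driverPast X₀ N₁ U N₂ D (s + n * h)] fun ω =>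
        ∑ i ∈ Finset.range n, c i * (bilateralCompoundSum N₁ U N₂ D (s + (i + 1 : ℕ) * h) ω -
        bilateralCompoundSum N₁ U N₂ D (s + i * h) ω) := by
      refine measurable_sum_range fun i hi => ?_
      have h1 : s + (i + 1 : ℕ) * h ≤ s + n * h := by gcongr; exact hi
      have h2 : s + (i : ℕ) * h ≤ s + n * h := by gcongr
      exact ((measurable_bilateralCompoundSum_driverPast h1).sub
        (measurable_bilateralCompoundSum_driverPast h2)).const_mul (c i)
    have hexp : Measurable fun p : ℝ => Complex.exp (ξ * (p : ℂ) * Complex.I) := by fun_prop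
    refine Eq.trans (integral_congr_ae (ae_of_all _ fun ω => ?_))
      (integral_mul_cexp_increment hZ hβ₁ hβ₂ (s + n * h) h
        (f := fun ω => f ω * Complex.exp (ξ * ((∑ i ∈ Finset.range n, c i *
          (bilateralCompoundSum N₁ U N₂ D (s + (i + 1 : ℕ) * h) ω -
            bilateralCompoundSum N₁ U N₂ D (s + i * h) ω) : ℝ) : ℂ) * Complex.I))
        ((hf.mono (driverPast_mono hsn) le_rfl).mul (hexp.comp hS)) (ξ * c n))
    simp only
    rw [mul_assoc (f ω), ← Complex.exp_add, Finset.sum_range_succ]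
    have e : s + ((n + 1 : ℕ) : ℝ≥0) * h = s + n * h + h := by push_cast; ring
    rw [e]
    congr 2
    push_cast
    ring

end Driver

end

/-! ### Solutions of the equation and the law of the remainder -/

section

open Filter Topology

theorem continuousWithinAt_sum_range_toNNReal {n : ℝ≥0 → ℕ}
    (hn : ∀ t, ContinuousWithinAt n (Ici t) t) (V : ℕ → ℝ) (u : ℝ) :
    ContinuousWithinAt (fun v : ℝ => ∑ i ∈ Finset.range (n v.toNNReal), V i) (Ici u) u := by
  have h1 : ContinuousWithinAt (fun v : ℝ≥0 => ∑ i ∈ Finset.range (n v), V i) (Ici u.toNNReal)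
      u.toNNReal :=
    (continuous_of_discreteTopology (f := fun j : ℕ => ∑ i ∈ Finset.range j, V i)).continuousAt
      |>.comp_continuousWithinAt (hn _)
  exact h1.comp continuous_real_toNNReal.continuousWithinAt fun v hv => Real.toNNReal_mono hv

theorem abs_sum_range_le_sum_abs {n : ℝ≥0 → ℕ} (hn : Monotone n) (V : ℕ → ℝ) {u T : ℝ≥0}
    (hu : u ≤ T) : |∑ i ∈ Finset.range (n u), V i| ≤ ∑ i ∈ Finset.range (n T), |V i| :=
  (Finset.abs_sum_le_sum_abs _ _).trans
    (Finset.sum_le_sum_of_subset_of_nonneg (Finset.range_mono (hn hu)) fun _ _ _ => abs_nonneg _)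

section Solution

variable {Ω : Type*} [mΩ : MeasurableSpace Ω] {P : Measure Ω} {k : ℝ} {Z : ℝ≥0 → Ω → ℝ}
  {X : ℝ≥0 → Ω → ℝ}

theorem IsOUSolution.ae_eq_initial {s : ℝ≥0} {ξ : Ω → ℝ} (h : IsOUSolution P k Z s ξ X) :
    X s =ᵐ[P] ξ := by
  filter_upwards [h.eqn] with ω hω
  simpa using (hω s le_rfl).2

theorem IsOUSolution.restart {r s : ℝ≥0} {ξ : Ω → ℝ} (h : IsOUSolution P k Z r ξ X)
    (hrs : r ≤ s) : IsOUSolution P k Z s (X s) X where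
  measurable t ht := h.measurable t (hrs.trans ht)
  eqn := by
    filter_upwards [h.eqn] with ω hω t ht
    obtain ⟨hs, es⟩ := hω s hrs
    obtain ⟨hi, et⟩ := hω t (hrs.trans ht)
    have hst := hs.symm.trans hi
    refine ⟨hst, ?_⟩
    rw [et, es, ← intervalIntegral.integral_add_adjacent_intervals hs hst]
    ring

end Solution

section Driver

variable {Ω : Type*} [mΩ : MeasurableSpace Ω] {P : Measure Ω}
  {k l₁ β₁ l₂ β₂ : ℝ} {X₀ : Ω → ℝ} {N₁ : ℝ≥0 → Ω → ℕ} {U : ℕ → Ω → ℝ}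
  {N₂ : ℝ≥0 → Ω → ℕ} {D : ℕ → Ω → ℝ} {X : ℝ≥0 → Ω → ℝ} {s : ℝ≥0} {ξ : Ω → ℝ}

/-- The Riemann-Stieltjes sum of `u ↦ exp (-k (s + t - u))` against the driver, on the uniform
subdivision of `[s, s + t]` into `n + 1` intervals. -/
noncomputable def weightedIncrementSum (k : ℝ) (Z : ℝ≥0 → Ω → ℝ) (s t : ℝ≥0) (n : ℕ) (ω : Ω) : ℝ :=
  ∑ i ∈ Finset.range (n + 1), Real.exp (-(k * (s + t - gridPoint s t n i))) *
    (Z (s + (i + 1 : ℕ) * (t / (n + 1))) ω - Z (s + i * (t / (n + 1))) ω)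

theorem IsOUSolution.tendsto_weightedIncrementSum
    (hZ : IsBilateralExpDriver P l₁ β₁ l₂ β₂ X₀ N₁ U N₂ D)
    (hX : IsOUSolution P k (bilateralCompoundSum N₁ U N₂ D) s ξ X) (t : ℝ≥0) :
    ∀ᵐ ω ∂P, Tendsto (fun n => weightedIncrementSum k (bilateralCompoundSum N₁ U N₂ D) s t n ω)
      atTop (𝓝 (X (s + t) ω - Real.exp (-(k * t)) * X s ω)) := by
  filter_upwards [hX.eqn, hZ.poisson_up.paths, hZ.poisson_down.paths] with ω hω h₁ h₂
  have hcast : ∀ u : ℝ, (s : ℝ) ≤ u → s ≤ u.toNNReal ∧ (u.toNNReal : ℝ) = u := fun u hu =>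
    ⟨by simpa using Real.toNNReal_mono hu, Real.coe_toNNReal u (s.coe_nonneg.trans hu)⟩
  have key := tendsto_sum_exp_mul_increment (x := fun u => X u.toNNReal ω)
    (z := fun u => bilateralCompoundSum N₁ U N₂ D u.toNNReal ω) (k := k) (ξ := ξ ω) (s := s)
    (t := t) (C := ∑ i ∈ Finset.range (N₁ (s + t) ω), |U i ω| +
      ∑ i ∈ Finset.range (N₂ (s + t) ω), |D i ω|) t.coe_nonneg ?_ ?_ ?_ ?_
  · have hg : ∀ (n i : ℕ), (gridPoint s t n i).toNNReal = s + i * (t / (n + 1)) := fun n i => by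
      have : gridPoint s t n i = ((s + i * (t / (n + 1)) : ℝ≥0) : ℝ) := by
        simp [gridPoint]
      rw [this, Real.toNNReal_coe]
    simp only [hg, Real.toNNReal_coe, ← NNReal.coe_add] at key
    simpa only [weightedIncrementSum, NNReal.coe_add] using key
  · intro u hu
    obtain ⟨h1, h2⟩ := hcast u hu
    simpa only [h2] using (hω _ h1).1
  · intro u hu
    obtain ⟨h1, h2⟩ := hcast u hu
    simpa only [h2, Real.toNNReal_coe] using (hω _ h1).2
  · intro u _
    exact (continuousWithinAt_sum_range_toNNReal h₁.2 (fun n => U n ω) u).sub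
      (continuousWithinAt_sum_range_toNNReal h₂.2 (fun n => D n ω) u)
  · intro u _ hu
    have hu' : u.toNNReal ≤ s + t := by
      rw [Real.toNNReal_le_iff_le_coe]
      simpa using hu
    exact (abs_sub _ _).trans (add_le_add
      (abs_sum_range_le_sum_abs h₁.1 (fun n => U n ω) hu')
      (abs_sum_range_le_sum_abs h₂.1 (fun n => D n ω) hu'))

omit mΩ in
theorem measurable_weightedIncrementSum (k : ℝ) (s t : ℝ≥0) (n : ℕ) :
    Measurable[driverPast X₀ N₁ U N₂ D (s + t)]
      (weightedIncrementSum k (bilateralCompoundSum N₁ U N₂ D) s t n) := by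
  have hle : ∀ i : ℕ, i ≤ n + 1 → s + i * (t / (n + 1)) ≤ s + t := fun i hi => by
    have h0 : ((n : ℝ≥0) + 1) ≠ 0 := by positivity
    have h1 : (i : ℝ≥0) ≤ n + 1 := by exact_mod_cast hi
    calc s + i * (t / (n + 1)) ≤ s + (n + 1) * (t / (n + 1)) := by gcongr
      _ = s + t := by rw [mul_div_cancel₀ _ h0]
  refine measurable_sum_range fun i hi => ?_
  exact ((measurable_bilateralCompoundSum_driverPast (hle (i + 1) (by omega))).sub
    (measurable_bilateralCompoundSum_driverPast (hle i (by omega)))).const_mul _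

theorem IsOUSolution.exists_measurable_ae_eq
    (hZ : IsBilateralExpDriver P l₁ β₁ l₂ β₂ X₀ N₁ U N₂ D)
    (hX : IsOUSolution P k (bilateralCompoundSum N₁ U N₂ D) 0 X₀ X) (u : ℝ≥0) :
    ∃ g, Measurable[driverPast X₀ N₁ U N₂ D u] g ∧ X u =ᵐ[P] g := by
  -- The weighted sums converge only almost surely; their `limsup` is measurable for the driver's
  -- past without exception.
  refine ⟨fun ω => limsup (fun n =>
    weightedIncrementSum k (bilateralCompoundSum N₁ U N₂ D) 0 u n ω) atTop +
      Real.exp (-(k * u)) * X₀ ω, ?_, ?_⟩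
  · have h := fun n => measurable_weightedIncrementSum (X₀ := X₀) (N₁ := N₁) (U := U) (N₂ := N₂)
      (D := D) k 0 u n
    rw [zero_add] at h
    exact (Measurable.limsup h).add ((measurable_initial_driverPast u).const_mul _)
  · filter_upwards [hX.tendsto_weightedIncrementSum hZ u, hX.ae_eq_initial] with ω hω h0
    rw [hω.limsup_eq, h0, zero_add]
    ring

/-- A solution is determined by the driver only up to null sets, so its past lies in the driver's
past completed by almost sure equality. -/
theorem IsOUSolution.past_le (hZ : IsBilateralExpDriver P l₁ β₁ l₂ β₂ X₀ N₁ U N₂ D)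
    (hX : IsOUSolution P k (bilateralCompoundSum N₁ U N₂ D) 0 X₀ X) (s : ℝ≥0) :
    ⨆ u : Iic s, MeasurableSpace.comap (X u) inferInstance ≤
      eventuallyMeasurableSpace (driverPast X₀ N₁ U N₂ D s) (ae P) := by
  refine iSup_le fun u => ?_
  obtain ⟨g, hg, hXg⟩ := hX.exists_measurable_ae_eq hZ u
  have : EventuallyMeasurable (driverPast X₀ N₁ U N₂ D s) (ae P) (X u) :=
    EventuallyMeasurable.congr
      (Measurable.eventuallyMeasurable (hg.mono (driverPast_mono u.2) le_rfl)) hXg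
  exact Measurable.comap_le this

/-- Restricting to an arbitrary past event `A` yields the law of the remainder and its independence
of the past at once. The integral over `A` of the exponential of the weighted sum has two limits: by
dominated convergence and by the explicit product. -/
theorem map_restrict_remainder [IsProbabilityMeasure P] (hk : 0 < k) (hl₁ : 0 < l₁) (hβ₁ : 0 < β₁)
    (hl₂ : 0 < l₂) (hβ₂ : 0 < β₂) (hZ : IsBilateralExpDriver P l₁ β₁ l₂ β₂ X₀ N₁ U N₂ D)
    (hX : IsOUSolution P k (bilateralCompoundSum N₁ U N₂ D) s ξ X) {t : ℝ≥0} (ht : 0 < t)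
    {A : Set Ω} (hA : MeasurableSet[driverPast X₀ N₁ U N₂ D s] A) :
    (P.restrict A).map (fun ω => X (s + t) ω - Real.exp (-(k * t)) * X s ω) =
      P A • polyaErlangMeasure (Real.exp (-(k * t))) (l₁ / k) β₁ (l₂ / k) β₂ := by
  have ht' : (0 : ℝ) < t := ht
  have ha1 : Real.exp (-(k * t)) ≤ 1 := Real.exp_le_one_iff.2 (by nlinarith)
  have ha := Real.exp_pos (-(k * t))
  have := isProbabilityMeasure_polyaErlangMeasure ha ha1 (div_pos hl₁ hk) hβ₁ (div_pos hl₂ hk) hβ₂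
  have : IsFiniteMeasure (P A •
      polyaErlangMeasure (Real.exp (-(k * t))) (l₁ / k) β₁ (l₂ / k) β₂) :=
    Measure.smul_finite _ (measure_ne_top _ _)
  have hA' : MeasurableSet A := driverPast_le hZ s A hA
  have hI : Measurable fun ω => X (s + t) ω - Real.exp (-(k * t)) * X s ω :=
    (hX.measurable _ le_self_add).sub ((hX.measurable _ le_rfl).const_mul _)
  have hS := fun n => (measurable_weightedIncrementSum (X₀ := X₀) (N₁ := N₁) (U := U) (N₂ := N₂)
    (D := D) k s t n).mono (driverPast_le hZ (s + t)) le_rfl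
  refine Measure.ext_of_charFun (funext fun x => ?_)
  have hexp : Continuous fun p : ℝ => Complex.exp (x * (p : ℂ) * Complex.I) := by fun_prop
  rw [charFun_apply_real, integral_map hI.aemeasurable hexp.aestronglyMeasurable,
    charFun_apply_real, integral_smul_measure, ← charFun_apply_real,
    charFun_polyaErlangMeasure ha ha1 (div_pos hl₁ hk) hβ₁ (div_pos hl₂ hk) hβ₂]
  have h1 : Tendsto (fun n => ∫ ω in A, Complex.exp (x *
      (weightedIncrementSum k (bilateralCompoundSum N₁ U N₂ D) s t n ω : ℂ) * Complex.I) ∂P) atTop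
      (𝓝 (∫ ω in A, Complex.exp (x *
        ((X (s + t) ω - Real.exp (-(k * t)) * X s ω : ℝ) : ℂ) * Complex.I) ∂P)) := by
    refine tendsto_integral_of_dominated_convergence (fun _ => 1)
      (fun n => (hexp.measurable.comp (hS n)).aestronglyMeasurable) (integrable_const _)
      (fun n => ae_of_all _ fun ω => ?_) ?_
    · rw [← Complex.ofReal_mul, Complex.norm_exp_ofReal_mul_I]
    · filter_upwards [ae_restrict_of_ae (hX.tendsto_weightedIncrementSum hZ t)] with ω hω
      exact (hexp.tendsto _).comp hω
  have h2 : Tendsto (fun n => ∫ ω in A, Complex.exp (x *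
      (weightedIncrementSum k (bilateralCompoundSum N₁ U N₂ D) s t n ω : ℂ) * Complex.I) ∂P) atTop
      (𝓝 ((P A).toReal • (polyaErlangCharFun (Real.exp (-(k * t))) (l₁ / k) β₁ x *
        polyaErlangCharFun (Real.exp (-(k * t))) (l₂ / k) β₂ (-x)))) := by
    have hlim := ((tendsto_prod_compoundPoissonExpCharFun hk hβ₁ ht' l₁ x s).mul
      (tendsto_prod_compoundPoissonExpCharFun hk hβ₂ ht' l₂ (-x) s)).const_mul
      ((P A).toReal : ℂ)
    rw [Complex.real_smul]
    refine hlim.congr fun n => ?_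
    have hf : Measurable[driverPast X₀ N₁ U N₂ D s] (A.indicator (fun _ => (1 : ℂ))) :=
      measurable_const.indicator hA
    have h := integral_mul_cexp_sum_increment hZ hβ₁ hβ₂ s (t / (n + 1)) hf
      (fun i => Real.exp (-(k * (s + t - gridPoint s t n i)))) x (n + 1)
    rw [integral_indicator_const _ hA', Finset.prod_mul_distrib] at h
    rw [← integral_indicator hA']
    refine Eq.trans ?_ (h.symm.trans (integral_congr_ae (ae_of_all _ fun ω => ?_)))
    · simp [Real.coe_toNNReal _ hl₁.le, Real.coe_toNNReal _ hl₂.le, Measure.real]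
    · by_cases hω : ω ∈ A
      · simp only [indicator_of_mem hω, one_mul]
        rfl
      · simp [indicator_of_notMem hω]
  exact tendsto_nhds_unique h1 h2

end Driver

end

/-! ### The transition kernel and the Markov property -/

section Translation

/-- The kernel that sends `y` to the translate of `μ` by `a * y`. -/
noncomputable def translationKernel (μ : Measure ℝ) (a : ℝ) : Kernel ℝ ℝ :=
  (Kernel.id ×ₖ Kernel.const ℝ μ).map fun p => p.2 + a * p.1

theorem translationKernel_apply (μ : Measure ℝ) [SFinite μ] (a y : ℝ) :
    translationKernel μ a y = μ.map fun x => x + a * y := by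
  have hf : Measurable fun p : ℝ × ℝ => p.2 + a * p.1 := by fun_prop
  rw [translationKernel, Kernel.map_apply _ hf, Kernel.prod_apply, Kernel.id_apply,
    Kernel.const_apply, Measure.dirac_prod, Measure.map_map hf measurable_prodMk_left]
  rfl

instance (μ : Measure ℝ) [IsProbabilityMeasure μ] (a : ℝ) :
    IsMarkovKernel (translationKernel μ a) :=
  Kernel.IsMarkovKernel.map _ (by fun_prop)

theorem map_prod_add_mul_eq_compProd (ν μ : Measure ℝ) [SFinite ν] [IsProbabilityMeasure μ]
    (a : ℝ) : (ν.prod μ).map (fun p => (p.1, p.2 + a * p.1)) = ν ⊗ₘ translationKernel μ a := by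
  have hf : Measurable fun p : ℝ × ℝ => (p.1, p.2 + a * p.1) := by fun_prop
  ext S hS
  rw [Measure.map_apply hf hS, Measure.prod_apply (hf hS), Measure.compProd_apply hS]
  refine lintegral_congr fun y => ?_
  rw [translationKernel_apply, Measure.map_apply (by fun_prop) (measurable_prodMk_left hS)]
  rfl

end Translation

section Driver

variable {Ω : Type*} [mΩ : MeasurableSpace Ω] {P : Measure Ω} [IsProbabilityMeasure P]
  {k l₁ β₁ l₂ β₂ : ℝ} {X₀ : Ω → ℝ} {N₁ : ℝ≥0 → Ω → ℕ} {U : ℕ → Ω → ℝ}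
  {N₂ : ℝ≥0 → Ω → ℕ} {D : ℕ → Ω → ℝ} {X : ℝ≥0 → Ω → ℝ}

/-- On `A` the remainder is independent of `X s`, so their joint law is a product; the shear `(y, z)
↦ (y, z + a y)` turns it into the law of `(X s, X (s + t))`. -/
theorem map_restrict_pair (hk : 0 < k) (hl₁ : 0 < l₁) (hβ₁ : 0 < β₁)
    (hl₂ : 0 < l₂) (hβ₂ : 0 < β₂) (hZ : IsBilateralExpDriver P l₁ β₁ l₂ β₂ X₀ N₁ U N₂ D)
    (hX : IsOUSolution P k (bilateralCompoundSum N₁ U N₂ D) 0 X₀ X) (s : ℝ≥0) {t : ℝ≥0}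
    (ht : 0 < t) {A : Set Ω}
    (hA : MeasurableSet[⨆ u : Iic s, MeasurableSpace.comap (X u) inferInstance] A) :
    (P.restrict A).map (fun ω => (X s ω, X (s + t) ω)) =
      (P.restrict A).map (X s) ⊗ₘ translationKernel
        (polyaErlangMeasure (Real.exp (-(k * t))) (l₁ / k) β₁ (l₂ / k) β₂)
        (Real.exp (-(k * t))) := by
  have ht' : (0 : ℝ) < t := ht
  have := isProbabilityMeasure_polyaErlangMeasure (Real.exp_pos (-(k * t)))
    (Real.exp_le_one_iff.2 (by nlinarith)) (div_pos hl₁ hk) hβ₁ (div_pos hl₂ hk) hβ₂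
  have hXm : ∀ u, Measurable (X u) := fun u => hX.measurable u u.2
  have hI : Measurable fun ω => X (s + t) ω - Real.exp (-(k * t)) * X s ω :=
    (hXm _).sub ((hXm _).const_mul _)
  have hpair : (P.restrict A).map (fun ω => (X s ω, X (s + t) ω - Real.exp (-(k * t)) * X s ω)) =
      ((P.restrict A).map (X s)).prod
        (polyaErlangMeasure (Real.exp (-(k * t))) (l₁ / k) β₁ (l₂ / k) β₂) := by
    refine (Measure.prod_eq fun B C hB hC => ?_).symm
    have hAB : MeasurableSet[⨆ u : Iic s, MeasurableSpace.comap (X u) inferInstance]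
        (X s ⁻¹' B ∩ A) :=
      MeasurableSet.inter (le_iSup (fun u : Iic s => MeasurableSpace.comap (X u) inferInstance)
        ⟨s, mem_Iic.2 le_rfl⟩ _ ⟨B, hB, rfl⟩) hA
    -- The event is exchanged for one in the driver's past that differs from it by a null set.
    obtain ⟨A', hA', hAA'⟩ := hX.past_le hZ s _ hAB
    have h := map_restrict_remainder hk hl₁ hβ₁ hl₂ hβ₂ hZ (hX.restart (zero_le (a := s))) ht hA'
    rw [← Measure.restrict_congr_set hAA', ← measure_congr hAA'] at h
    have h' := congrArg (fun m => m C) h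
    simp only [Measure.map_apply hI hC, Measure.smul_apply, smul_eq_mul] at h'
    rw [Measure.restrict_apply (hI hC)] at h'
    rw [Measure.map_apply ((hXm s).prodMk hI) (hB.prod hC), Measure.map_apply (hXm s) hB,
      Measure.restrict_apply (((hXm s).prodMk hI) (hB.prod hC)),
      Measure.restrict_apply (hXm s hB), ← h']
    congr 1
    ext ω
    simp only [mem_inter_iff, mem_preimage, mem_prod]
    tauto
  rw [← map_prod_add_mul_eq_compProd, ← hpair, Measure.map_map (by fun_prop) ((hXm s).prodMk hI)]
  congr 1
  ext ω <;> simp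

theorem setLIntegral_translationKernel (hk : 0 < k) (hl₁ : 0 < l₁) (hβ₁ : 0 < β₁)
    (hl₂ : 0 < l₂) (hβ₂ : 0 < β₂) (hZ : IsBilateralExpDriver P l₁ β₁ l₂ β₂ X₀ N₁ U N₂ D)
    (hX : IsOUSolution P k (bilateralCompoundSum N₁ U N₂ D) 0 X₀ X) (s : ℝ≥0) {t : ℝ≥0}
    (ht : 0 < t) {A : Set Ω}
    (hA : MeasurableSet[⨆ u : Iic s, MeasurableSpace.comap (X u) inferInstance] A)
    {B : Set ℝ} (hB : MeasurableSet B) :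
    ∫⁻ ω in A, translationKernel
        (polyaErlangMeasure (Real.exp (-(k * t))) (l₁ / k) β₁ (l₂ / k) β₂)
        (Real.exp (-(k * t))) (X s ω) B ∂P = P (X (s + t) ⁻¹' B ∩ A) := by
  have ht' : (0 : ℝ) < t := ht
  have := isProbabilityMeasure_polyaErlangMeasure (Real.exp_pos (-(k * t)))
    (Real.exp_le_one_iff.2 (by nlinarith)) (div_pos hl₁ hk) hβ₁ (div_pos hl₂ hk) hβ₂
  have hXm : ∀ u, Measurable (X u) := fun u => hX.measurable u u.2
  have h := congrArg (fun m => m (univ ×ˢ B))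
    (map_restrict_pair hk hl₁ hβ₁ hl₂ hβ₂ hZ hX s ht hA)
  rw [Measure.compProd_apply_prod MeasurableSet.univ hB, Measure.restrict_univ,
    lintegral_map (Kernel.measurable_coe _ hB) (hXm s),
    Measure.map_apply ((hXm s).prodMk (hXm _)) (MeasurableSet.univ.prod hB),
    Measure.restrict_apply (((hXm s).prodMk (hXm _)) (MeasurableSet.univ.prod hB))] at h
  rw [← h]
  congr 1
  ext ω
  simp

end Driver

theorem mainTheorem6 {Ω : Type*} [MeasurableSpace Ω] (P : Measure Ω) [IsProbabilityMeasure P]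
    (k l₁ β₁ l₂ β₂ : ℝ) (hk : 0 < k) (hl₁ : 0 < l₁) (hβ₁ : 0 < β₁) (hl₂ : 0 < l₂) (hβ₂ : 0 < β₂)
    (X₀ : Ω → ℝ) (N₁ : ℝ≥0 → Ω → ℕ) (U : ℕ → Ω → ℝ) (N₂ : ℝ≥0 → Ω → ℕ) (D : ℕ → Ω → ℝ)
    (hZ : IsBilateralExpDriver P l₁ β₁ l₂ β₂ X₀ N₁ U N₂ D)
    (X : ℝ≥0 → Ω → ℝ)
    (hX : IsOUSolution P k (bilateralCompoundSum N₁ U N₂ D) 0 X₀ X)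
    (s t : ℝ≥0) (ht : 0 < t) (a : ℝ) (ha : a = Real.exp (-(k * t))) :
    -- the series defining `g_a` converge at every point
    (∀ x : ℝ, Summable (upTerm a (l₁ / k) β₁ (l₂ / k) x) ∧
      Summable (downTerm a (l₁ / k) (l₂ / k) β₂ x) ∧
      Summable (bothTerm a (l₁ / k) β₁ (l₂ / k) β₂ x)) ∧
    -- the law at time `s + t` of the process started from `y` at time `s`
    (∀ (y : ℝ) (Y : ℝ≥0 → Ω → ℝ),
      IsOUSolution P k (bilateralCompoundSum N₁ U N₂ D) s (fun _ => y) Y →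
      P.map (Y (s + t)) = remainderMeasureAt a (l₁ / k) β₁ (l₂ / k) β₂ (a * y)) ∧
    -- the conditional law of `X (s + t)` given `X s = y`
    (∀ᵐ y ∂(P.map (X s)), condDistrib (X (s + t)) (X s) P y =
      remainderMeasureAt a (l₁ / k) β₁ (l₂ / k) β₂ (a * y)) ∧
    -- the Markov property: the same conditional law given the past of `X` up to time `s`
    (∀ B : Set ℝ, MeasurableSet B →
      P[(X (s + t) ⁻¹' B).indicator (fun _ => (1 : ℝ)) |
          ⨆ u : Iic s, MeasurableSpace.comap (X u) inferInstance] =ᵐ[P]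
        fun ω => (remainderMeasureAt a (l₁ / k) β₁ (l₂ / k) β₂ (a * X s ω)).real B) := by
  have ht' : (0 : ℝ) < t := ht
  have ha0 : 0 < a := ha ▸ Real.exp_pos _
  have ha1 : a ≤ 1 := ha ▸ Real.exp_le_one_iff.2 (by nlinarith)
  have hα₁ := div_pos hl₁ hk
  have hα₂ := div_pos hl₂ hk
  have hμ := isProbabilityMeasure_polyaErlangMeasure ha0 ha1 hα₁ hβ₁ hα₂ hβ₂
  have hXm : ∀ u, Measurable (X u) := fun u => hX.measurable u u.2
  have hshift : ∀ c, (polyaErlangMeasure a (l₁ / k) β₁ (l₂ / k) β₂).map (fun x => x + c) =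
      remainderMeasureAt a (l₁ / k) β₁ (l₂ / k) β₂ c := fun c => by
    rw [← remainderMeasureAt_zero ha0 ha1 hα₁ hβ₁ hα₂ hβ₂, map_add_right_remainderMeasureAt]
  have hκ : ∀ y, translationKernel (polyaErlangMeasure a (l₁ / k) β₁ (l₂ / k) β₂) a y =
      remainderMeasureAt a (l₁ / k) β₁ (l₂ / k) β₂ (a * y) := fun y => by
    rw [translationKernel_apply, hshift]
  refine ⟨fun x => ⟨summable_upTerm ha0 ha1 hα₁ hβ₁ x, ?_,
    summable_bothTerm ha0 ha1 hα₁ hβ₁ hα₂ hβ₂ x⟩, fun y Y hY => ?_, ?_, fun B hB => ?_⟩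
  · rw [downTerm_eq_upTerm]
    exact summable_upTerm ha0 ha1 hα₂ hβ₂ (-x)
  -- With `A = univ` only the law of the remainder is used; `Y s = y` holds almost surely, which
  -- suffices for equality of laws.
  · have h := map_restrict_remainder hk hl₁ hβ₁ hl₂ hβ₂ hZ hY ht MeasurableSet.univ
    rw [Measure.restrict_univ, measure_univ, one_smul, ← ha] at h
    have hI : Measurable fun ω => Y (s + t) ω - a * Y s ω :=
      (hY.measurable _ le_self_add).sub ((hY.measurable _ le_rfl).const_mul _)
    rw [← hshift, ← h, Measure.map_map (by fun_prop) hI]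
    refine Measure.map_congr ?_
    filter_upwards [hY.ae_eq_initial] with ω hω
    simp [hω]
  · have h := map_restrict_pair hk hl₁ hβ₁ hl₂ hβ₂ hZ hX s ht MeasurableSet.univ
    rw [Measure.restrict_univ, ← ha] at h
    filter_upwards [condDistrib_ae_eq_of_measure_eq_compProd_of_measurable (hXm s) (hXm (s + t)) h]
      with y hy
    rw [hy, hκ]
  · have hm : ⨆ u : Iic s, MeasurableSpace.comap (X u) inferInstance ≤ _ :=
      iSup_le fun u => (hXm u).comap_le
    have hmeas : Measurable fun y =>
        (remainderMeasureAt a (l₁ / k) β₁ (l₂ / k) β₂ (a * y)).real B := by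
      simp_rw [← hκ]
      exact (Kernel.measurable_coe _ hB).ennreal_toReal
    have hXs : Measurable[⨆ u : Iic s, MeasurableSpace.comap (X u) inferInstance] (X s) :=
      (comap_measurable (X s)).mono (le_iSup (fun u : Iic s =>
        MeasurableSpace.comap (X u) inferInstance) ⟨s, mem_Iic.2 le_rfl⟩) le_rfl
    have hprob : ∀ c, IsProbabilityMeasure (remainderMeasureAt a (l₁ / k) β₁ (l₂ / k) β₂ c) :=
      fun c => hshift c ▸ Measure.isProbabilityMeasure_map (by fun_prop)
    have hint : Integrable (fun ω =>
        (remainderMeasureAt a (l₁ / k) β₁ (l₂ / k) β₂ (a * X s ω)).real B) P :=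
      Integrable.of_bound (hmeas.comp (hXm s)).aestronglyMeasurable 1
        (ae_of_all _ fun ω => by
          rw [Real.norm_of_nonneg measureReal_nonneg]
          exact measureReal_le_one)
    -- The defining property of the conditional expectation: over each event of the past of `X`, the
    -- kernel and the indicator have the same integral.
    refine (ae_eq_condExp_of_forall_setIntegral_eq hm
      ((integrable_const (1 : ℝ)).indicator (hXm _ hB)) (fun A _ _ => hint.integrableOn)
      (fun A hA _ => ?_) (hmeas.comp hXs).stronglyMeasurable.aestronglyMeasurable).symm
    have h := setLIntegral_translationKernel hk hl₁ hβ₁ hl₂ hβ₂ hZ hX s ht hA hB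
    simp only [← ha, hκ] at h
    rw [integral_indicator_const _ (hXm _ hB), smul_eq_mul, mul_one,
      measureReal_restrict_apply (hXm _ hB), measureReal_def, ← h]
    simp only [measureReal_def]
    exact integral_toReal (by
      simp_rw [← hκ]
      exact ((Kernel.measurable_coe _ hB).comp (hXm s)).aemeasurable)
      (ae_of_all _ fun ω => measure_lt_top _ _)
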